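/- Let $p$ be a prime, let $\mathbb{Q}_p$ be the additive group (field) of $p$-adic numbers with its Borel $\sigma$-algebra, $\mathbb{Z}_p$ the ring of $p$-adic integers and $\mathbb{Z}_p^{\times}$ its group of units. A probability distribution on $\mathbb{Q}_p$ is called degenerate if it is concentrated at one point, and idempotent if it is a shift of the normalized Haar measure of a compact subgroup of $\mathbb{Q}_p$ (degenerate distributions are idempotent). Let $\delta_j=p^{k_j}c_j$ and $\varepsilon_j=p^{l_j}d_j$, where $c_j,d_j\in\mathbb{Z}_p^{\times}$ and $k_j\ge 0$, $l_j\ge 0$ are integers, $j=1,2$, and put $k=\min\{k_1,k_2,l_1,l_2\}$. Let $\Lambda$ be one of the matrices $$\Lambda_1=\begin{pmatrix}1&1&1\\1&\delta_1&\delta_2\\1&\varepsilon_1&\varepsilon_2\end{pmatrix},\qquad \Lambda_2=\begin{pmatrix}1&1&1\\\delta_1&1&\delta_2\\1&\varepsilon_1&\varepsilon_2\end{pmatrix},$$ and suppose that $\det\Lambda=p^{q}\lambda$ with an integer $q\ge 0$ and $\lambda\in\mathbb{Z}_p^{\times}$. Call a triple $(\mu_1,\mu_2,\mu_3)$ admissible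 for $\Lambda$ if there are independent random variables $\xi_1,\xi_2,\xi_3$ with values in $\mathbb{Q}_p$ and distributions $\mu_1,\mu_2,\mu_3$ such that the three components of the random vector $(L_1,L_2,L_3)=\Lambda(\xi_1,\xi_2,\xi_3)$ are independent. Then the following statements hold. (A) Let $q=0$. For every admissible triple all $\mu_j$ are idempotent if and only if each row and each column of $\Lambda$ contains at least two elements of $\mathbb{Z}_p^{\times}$. (B) Let $q>0$. (B.1) If at least one of $\delta_1,\delta_2,\varepsilon_1,\varepsilon_2$ lies in $\mathbb{Z}_p^{\times}$, then for every admissible triple all $\mu_j$ are degenerate. (B.2) Suppose that none of $\delta_1,\delta_2,\varepsilon_1,\varepsilon_2$ lies in $\mathbb{Z}_p^{\times}$. For every admissible triple all $\mu_j$ are idempotent if and only if either $q>k$, or $q=k$ and ($k_1=l_2=k$ or $k_2=l_1=k$). Moreover, if $q>k$, then for every admissible triple all $\mu_j$ are degenerate. -/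

import Mathlib

open MeasureTheory ProbabilityTheory

universe u

/-- The set `Δ_p⁰` of invertible `p`-adic integers, viewed inside `ℚ_[p]`. -/
def padicUnits (p : ℕ) [Fact p.Prime] : Set ℚ_[p] :=
  Set.range fun u : ℤ_[p]ˣ => ((u : ℤ_[p]) : ℚ_[p])

/-- The set `D(X)` of degenerate distributions on `X`. -/
def degenerateDistributions (X : Type*) [MeasurableSpace X] : Set (Measure X) :=
  {μ | ∃ x : X, μ = Measure.dirac x}

/-- The set `I(X)` of idempotent distributions on `X`: all shifts, by elements `x` of `X`, of the
Haar distributions (normalized Haar measures) `m` of the compact subgroups `K` of `X`. -/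
def idempotentDistributions (X : Type*) [AddCommGroup X] [TopologicalSpace X]
    [MeasurableSpace X] : Set (Measure X) :=
  {μ | ∃ (K : AddSubgroup X) (m : Measure K) (x : X), IsCompact (K : Set X) ∧
    m.IsAddHaarMeasure ∧ IsProbabilityMeasure m ∧ μ = m.map fun y : K => x + (y : X)}

/-- The first normalized coefficient matrix. -/
def Lambda1 {R : Type*} [One R] (δ₁ δ₂ ε₁ ε₂ : R) : Matrix (Fin 3) (Fin 3) R :=
  !![1, 1, 1;
     1, δ₁, δ₂;
     1, ε₁, ε₂]

/-- The second normalized coefficient matrix. -/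
def Lambda2 {R : Type*} [One R] (δ₁ δ₂ ε₁ ε₂ : R) : Matrix (Fin 3) (Fin 3) R :=
  !![1, 1, 1;
     δ₁, 1, δ₂;
     1, ε₁, ε₂]

/-- Whenever `ξ 0, ξ 1, ξ 2` are independent random variables with values in `ℚ_[p]`, on any
probability space, such that the random vector `Λ ξ` has independent components, all three
distributions of the `ξ j` belong to the class `C`. -/
def IndependenceForces {p : ℕ} [Fact p.Prime] [MeasurableSpace ℚ_[p]]
    (Λ : Matrix (Fin 3) (Fin 3) ℚ_[p]) (C : Set (Measure ℚ_[p])) : Prop :=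
  ∀ (Ω : Type u) [MeasurableSpace Ω] (P : Measure Ω) [IsProbabilityMeasure P]
    (ξ : Fin 3 → Ω → ℚ_[p]),
    (∀ j, Measurable (ξ j)) → iIndepFun ξ P →
    iIndepFun (fun (i : Fin 3) (ω : Ω) => Λ.mulVec (fun j => ξ j ω) i) P →
    ∀ j, P.map (ξ j) ∈ C

/-!
For a distribution `μ` on `ℚ_[p]` let `charNorm μ y = |φ_μ(y)|` be the modulus of its
characteristic function, formed with a fixed character of `ℚ_[p]` trivial on `ℤ_[p]`. Then `μ` is
degenerate if `charNorm μ` is identically `1`, and idempotent if and only if `charNorm μ` takes no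
values other than `0` and `1` (`mem_idempotentDistributions_iff`).

Let `N = Λ⁻¹`. Independence of the components of `Λ ξ` gives, with `f j` the modulus belonging to
`ξ j`, the functional equation `f j (s) = ∏ i, ∏ j', f j' (Λ i j' * N j i * s)`
(`charNorm_eq_prod_of_iIndepFun_mulVec`). As all factors lie in `[0, 1]`, each of them is an upper
bound for the left-hand side, and this has two consequences.

* If `c = Λ i j * N j i` has norm greater than `1`, then `f j (s) ≥ f j (c⁻ⁿ s) → f j (0) = 1`, so
  that all three distributions are degenerate (`charNorm_eq_one_of_one_lt_norm`).
* If `Λ` is invertible over `ℤ_[p]`, compare maxima over a sphere `‖s‖ = r`. Two units in a row of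
  `Λ` give an inequality `m ≤ m * f j' (t)` with `‖t‖ = r`, hence `f j' = 1` on the sphere as soon
  as `m ≠ 0`. Two units in every row and column make the relation "`f j` is bounded by `f j'` on
  the sphere" strongly connected, so all `f j` equal `1` there (`charNorm_eq_zero_or_one`).

Conversely, let `Λ` be invertible over `ℤ_[p]` and let some row or column have only one unit, at
position `(i, j)`. Give `ξ j` the mixture of the Haar distributions of `ℤ_[p]` and `p ℤ_[p]`, and
the other variables one of these two Haar distributions. The law of `ξ` is a mixture of two uniform
distributions on boxes, which `Λ` carries onto two boxes differing in the `i`-th factor only; so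
`Λ ξ` has independent components (`not_independenceForces_of_line`). This settles all matrices
invertible over `ℤ_[p]` (`independenceForces_idempotent_iff`).

If `p ∣ det Λ`, then `N` is not integral. When one of `δ₁, δ₂, ε₁, ε₂` is a unit, the equations
`N Λ = Λ N = 1` then force some `Λ i j * N j i` to have norm greater than `1`. When none is a unit,
`Λ = Lambda1`, the lower right block of `N` consists of elements of norm `p ^ q`, and the same
conclusion holds for `q > k`; for `q = k`, multiplying the last two forms by `p⁻ᵏ` and the first
variable by `pᵏ` gives a matrix invertible over `ℤ_[p]`
(`independenceForces_idempotent_Lambda1_iff`).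
-/

/-! ### A nontrivial continuous character of `ℚ_[p]` -/

/-- Since `ℚ/ℤ` is injective, some homomorphism `ℚ_[p] / ℤ_[p] → ℚ/ℤ` does not vanish at the class
of `p⁻¹`; composing it with `ℚ/ℤ → ℝ/ℤ → Circle` gives the character. -/
theorem Padic.exists_addChar (p : ℕ) [Fact p.Prime] :
    ∃ χ : AddChar ℚ_[p] Circle,
      Continuous χ ∧ (∀ x, ‖x‖ ≤ 1 → χ x = 1) ∧ χ (p : ℚ_[p])⁻¹ ≠ 1 := by
  have hp : (1 : ℝ) < p := by exact_mod_cast (Fact.out : p.Prime).one_lt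
  let S : AddSubgroup ℚ_[p] := (PadicInt.subring p).toAddSubgroup
  have hS : ∀ x : ℚ_[p], x ∈ S ↔ ‖x‖ ≤ 1 := fun x => Iff.rfl
  have hne : QuotientAddGroup.mk' S (p : ℚ_[p])⁻¹ ≠ 0 := by
    rw [Ne, QuotientAddGroup.mk'_apply, QuotientAddGroup.eq_zero_iff, hS]
    simpa using hp
  obtain ⟨c, hc⟩ := CharacterModule.exists_character_apply_ne_zero_of_ne_zero hne
  -- the inclusion `ℚ/ℤ → ℝ/ℤ`
  let ι : AddCircle (1 : ℚ) →+ AddCircle (1 : ℝ) :=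
    QuotientAddGroup.map _ _ (Rat.castHom ℝ).toAddMonoidHom (by
      rw [AddSubgroup.zmultiples_le]
      exact ⟨1, by simp⟩)
  have hι : ∀ a, ι a = 0 → a = 0 := by
    intro a
    induction a using QuotientAddGroup.induction_on with
    | H q =>
      intro h
      have h' : ((q : ℝ) : AddCircle (1 : ℝ)) = 0 := h
      rw [AddCircle.coe_eq_zero_iff] at h'
      obtain ⟨n, hn⟩ := h'
      refine (AddCircle.coe_eq_zero_iff (1 : ℚ)).2 ⟨n, ?_⟩
      have : ((n : ℚ) : ℝ) = q := by simpa using hn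
      have : (n : ℚ) = q := by exact_mod_cast this
      simpa using this
  let c' : ℚ_[p] ⧸ S →+ AddCircle (1 : ℚ) := c
  let g : ℚ_[p] →+ AddCircle (1 : ℝ) := ι.comp (c'.comp (QuotientAddGroup.mk' S))
  let χ : AddChar ℚ_[p] Circle :=
    { toFun := fun x => AddCircle.toCircle (g x)
      map_zero_eq_one' := by simp
      map_add_eq_mul' := fun x y => by rw [map_add, AddCircle.toCircle_add] }
  have hχ : ∀ x, χ x = AddCircle.toCircle (g x) := fun _ => rfl
  have h1 : ∀ x, ‖x‖ ≤ 1 → χ x = 1 := by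
    intro x hx
    have h0 : (QuotientAddGroup.mk' S x) = 0 := (QuotientAddGroup.eq_zero_iff x).2 ((hS x).2 hx)
    have : g x = ι (c' (QuotientAddGroup.mk' S x)) := rfl
    rw [hχ, this, h0, map_zero, map_zero, AddCircle.toCircle_zero]
  refine ⟨χ, ?_, h1, ?_⟩
  · -- the character is locally constant, being trivial on the unit ball
    rw [continuous_iff_continuousAt]
    intro x
    refine (continuousAt_const (y := χ x)).congr ?_
    filter_upwards [Metric.closedBall_mem_nhds x one_pos] with y hy
    have : χ (y - x) = 1 := h1 _ (by simpa [dist_eq_norm] using hy)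
    have h2 : χ (x + (y - x)) = χ x := by rw [AddChar.map_add_eq_mul, this, mul_one]
    rw [← h2, add_sub_cancel]
  · intro h
    have : g (p : ℚ_[p])⁻¹ = 0 := by
      apply AddCircle.injective_toCircle one_ne_zero
      rw [← hχ, h, AddCircle.toCircle_zero]
    exact hc (hι _ this)

/-- A character of `ℚ_[p]` trivial on `ℤ_[p]` but not at `p⁻¹`. By means of the pairing
`(y, x) ↦ Padic.stdChar p (y * x)` the group `ℚ_[p]` is its own dual. -/
noncomputable def Padic.stdChar (p : ℕ) [Fact p.Prime] : AddChar ℚ_[p] Circle :=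
  (Padic.exists_addChar p).choose

section stdChar

variable {p : ℕ} [Fact p.Prime]

theorem Padic.continuous_stdChar : Continuous (Padic.stdChar p) :=
  (Padic.exists_addChar p).choose_spec.1

theorem Padic.stdChar_eq_one {x : ℚ_[p]} (hx : ‖x‖ ≤ 1) : Padic.stdChar p x = 1 :=
  (Padic.exists_addChar p).choose_spec.2.1 x hx

theorem Padic.stdChar_inv_ne_one : Padic.stdChar p (p : ℚ_[p])⁻¹ ≠ 1 :=
  (Padic.exists_addChar p).choose_spec.2.2

theorem Padic.norm_coe_stdChar (x : ℚ_[p]) : ‖(Padic.stdChar p x : ℂ)‖ = 1 := Circle.norm_coe _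

theorem Padic.norm_le_inv_of_norm_lt_one {x : ℚ_[p]} (hx : ‖x‖ < 1) : ‖x‖ ≤ (p : ℝ)⁻¹ := by
  have := (Padic.norm_le_pow_iff_norm_lt_pow_add_one x (-1)).2 (by simpa using hx)
  simpa using this

theorem Padic.eq_zero_of_stdChar_mul_eq_one {x : ℚ_[p]}
    (h : ∀ y, Padic.stdChar p (y * x) = 1) : x = 0 := by
  by_contra hx
  exact Padic.stdChar_inv_ne_one (by simpa [hx] using h ((p : ℚ_[p])⁻¹ * x⁻¹))

end stdChar

/-! ### Characteristic functions of distributions on `ℚ_[p]` -/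

section charNorm

open BoundedContinuousFunction

variable {p : ℕ} [Fact p.Prime]

/-- The bounded continuous function `x ↦ χ (y x)`, where `χ` is the standard character. -/
noncomputable def Padic.charBCF (y : ℚ_[p]) : ℚ_[p] →ᵇ ℂ :=
  BoundedContinuousFunction.ofNormedAddCommGroup (fun x => (Padic.stdChar p (y * x) : ℂ))
    (continuous_subtype_val.comp (Padic.continuous_stdChar.comp (continuous_const_mul y))) 1
    (fun _ => (Circle.norm_coe _).le)

theorem Padic.charBCF_apply (y x : ℚ_[p]) :
    Padic.charBCF y x = (Padic.stdChar p (y * x) : ℂ) := rfl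

variable [MeasurableSpace ℚ_[p]] [BorelSpace ℚ_[p]]

theorem Padic.measurable_stdChar_mul (y : ℚ_[p]) :
    Measurable fun x => (Padic.stdChar p (y * x) : ℂ) :=
  (Padic.charBCF y).continuous.measurable

/-- Finite measures on `ℚ_[p]` are determined by their characteristic functions: the characters
span a star subalgebra of the bounded continuous functions which separates points. -/
theorem Padic.measure_ext_of_integral_stdChar {μ ν : Measure ℚ_[p]} [IsFiniteMeasure μ]
    [IsFiniteMeasure ν]
    (h : ∀ y, ∫ x, (Padic.stdChar p (y * x) : ℂ) ∂μ = ∫ x, (Padic.stdChar p (y * x) : ℂ) ∂ν) :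
    μ = ν := by
  let S : Submonoid (ℚ_[p] →ᵇ ℂ) :=
    { carrier := Set.range Padic.charBCF
      one_mem' := ⟨0, by ext x; simp [Padic.charBCF_apply]⟩
      mul_mem' := by
        rintro _ _ ⟨y, rfl⟩ ⟨z, rfl⟩
        exact ⟨y + z, by ext x; simp [Padic.charBCF_apply, add_mul, AddChar.map_add_eq_mul]⟩ }
  have hstar : star (S : Set (ℚ_[p] →ᵇ ℂ)) ⊆ S := by
    rintro f ⟨y, hy⟩
    refine ⟨-y, ?_⟩
    rw [← star_star f, ← hy]
    ext x
    rw [Padic.charBCF_apply, neg_mul, AddChar.map_neg_eq_inv]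
    exact Circle.coe_inv_eq_conj _
  let A : StarSubalgebra ℂ (ℚ_[p] →ᵇ ℂ) := StarAlgebra.adjoin ℂ (S : Set (ℚ_[p] →ᵇ ℂ))
  have hA : ∀ g ∈ A, g ∈ Submodule.span ℂ (S : Set (ℚ_[p] →ᵇ ℂ)) := by
    intro g hg
    have h1 : g ∈ Algebra.adjoin ℂ ((S : Set (ℚ_[p] →ᵇ ℂ)) ∪ star (S : Set (ℚ_[p] →ᵇ ℂ))) := hg
    rw [Set.union_eq_self_of_subset_right hstar] at h1
    have h2 : g ∈ Subalgebra.toSubmodule (Algebra.adjoin ℂ (S : Set (ℚ_[p] →ᵇ ℂ))) := h1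
    rwa [Algebra.adjoin_eq_span, Submonoid.closure_eq] at h2
  refine ext_of_forall_mem_subalgebra_integral_eq_of_pseudoEMetric_complete_countable
    (A := A) ?_ ?_
  · intro x x' hxx
    by_contra hcon
    refine hxx (sub_eq_zero.1 (Padic.eq_zero_of_stdChar_mul_eq_one fun y => ?_))
    have hy : Padic.charBCF y x = Padic.charBCF y x' := by
      by_contra hne
      exact hcon ⟨_, ⟨_, ⟨Padic.charBCF y,
        StarAlgebra.subset_adjoin ℂ _ (Set.mem_range_self y), rfl⟩, rfl⟩, hne⟩
    have hy' : Padic.stdChar p (y * x) = Padic.stdChar p (y * x') := Circle.ext hy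
    rw [mul_sub, AddChar.map_sub_eq_div, hy', div_self']
  · intro g hg
    have hint : ∀ (f : ℚ_[p] →ᵇ ℂ) (ρ : Measure ℚ_[p]) [IsFiniteMeasure ρ], Integrable f ρ :=
      fun f ρ _ => f.integrable ρ
    have hg' := hA g hg
    clear hg
    induction hg' using Submodule.span_induction with
    | mem f hf => obtain ⟨y, rfl⟩ := hf; exact h y
    | zero => simp
    | add f g _ _ hf hg =>
      simp only [BoundedContinuousFunction.coe_add, Pi.add_apply]
      rw [integral_add (hint f μ) (hint g μ), integral_add (hint f ν) (hint g ν)]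
      exact congrArg₂ (· + ·) hf hg
    | smul a f _ hf =>
      simp only [BoundedContinuousFunction.coe_smul]
      rw [integral_smul, integral_smul]
      exact congrArg (a • ·) hf

/-- The modulus of the characteristic function of a distribution on `ℚ_[p]`. -/
noncomputable def charNorm (μ : Measure ℚ_[p]) (y : ℚ_[p]) : ℝ :=
  ‖∫ x, (Padic.stdChar p (y * x) : ℂ) ∂μ‖

variable {μ : Measure ℚ_[p]}

omit [BorelSpace ℚ_[p]] in
theorem charNorm_nonneg (y : ℚ_[p]) : 0 ≤ charNorm μ y := norm_nonneg _

theorem Padic.integrable_stdChar_mul [IsFiniteMeasure μ] (y : ℚ_[p]) :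
    Integrable (fun x => (Padic.stdChar p (y * x) : ℂ)) μ :=
  (Padic.charBCF y).integrable μ

theorem charNorm_map_const_mul (c y : ℚ_[p]) :
    charNorm (μ.map (c * ·)) y = charNorm μ (y * c) := by
  unfold charNorm
  rw [integral_map (by fun_prop) (Padic.measurable_stdChar_mul y).aestronglyMeasurable]
  simp only [mul_assoc]

variable [IsProbabilityMeasure μ]

omit [BorelSpace ℚ_[p]] in
theorem charNorm_le_one (y : ℚ_[p]) : charNorm μ y ≤ 1 := by
  have := norm_integral_le_of_norm_le_const (μ := μ) (C := 1)
    (f := fun x => (Padic.stdChar p (y * x) : ℂ))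
    (Filter.Eventually.of_forall fun x => (Padic.norm_coe_stdChar _).le)
  simpa [charNorm] using this

omit [BorelSpace ℚ_[p]] in
theorem charNorm_zero : charNorm μ 0 = 1 := by
  simp [charNorm]

theorem continuous_charNorm : Continuous (charNorm μ) := by
  refine continuous_norm.comp (continuous_of_dominated (bound := fun _ => 1)
    (fun y => (Padic.measurable_stdChar_mul y).aestronglyMeasurable)
    (fun y => Filter.Eventually.of_forall fun x => (Padic.norm_coe_stdChar _).le)
    (integrable_const _)
    (Filter.Eventually.of_forall fun x => ?_))
  exact continuous_subtype_val.comp (Padic.continuous_stdChar.comp (continuous_mul_const x))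

omit [BorelSpace ℚ_[p]] in
theorem charNorm_eq_one_iff {y : ℚ_[p]} :
    charNorm μ y = 1 ↔ ∃ c : Circle, ∀ᵐ x ∂μ, Padic.stdChar p (y * x) = c := by
  constructor
  · intro h
    rcases ae_eq_const_or_norm_integral_lt_of_norm_le_const (μ := μ) (C := 1)
      (f := fun x => (Padic.stdChar p (y * x) : ℂ))
      (Filter.Eventually.of_forall fun x => (Padic.norm_coe_stdChar _).le) with h1 | h1
    · obtain ⟨x₀, hx₀⟩ := h1.exists
      refine ⟨Padic.stdChar p (y * x₀), ?_⟩
      filter_upwards [h1] with x hx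
      exact Circle.ext (hx.trans hx₀.symm)
    · exact absurd h (ne_of_lt (by simpa [charNorm] using h1))
  · rintro ⟨c, hc⟩
    have : ∫ x, (Padic.stdChar p (y * x) : ℂ) ∂μ = ∫ _, (c : ℂ) ∂μ := by
      refine integral_congr_ae ?_
      filter_upwards [hc] with x hx
      rw [hx]
    simpa [charNorm, this] using Circle.norm_coe c

/-- The set where the modulus is `1` is closed under multiplication by `p`-adic integers. -/
theorem charNorm_mul_eq_one {y z : ℚ_[p]} (hy : charNorm μ y = 1) (hz : ‖z‖ ≤ 1) :
    charNorm μ (z * y) = 1 := by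
  have hnat : ∀ n : ℕ, charNorm μ ((n : ℚ_[p]) * y) = 1 := by
    intro n
    obtain ⟨c, hc⟩ := charNorm_eq_one_iff.1 hy
    refine charNorm_eq_one_iff.2 ⟨c ^ n, ?_⟩
    filter_upwards [hc] with x hx
    rw [mul_assoc, ← nsmul_eq_mul, AddChar.map_nsmul_eq_pow, hx]
  have hcl : IsClosed {w : ℤ_[p] | charNorm μ ((w : ℚ_[p]) * y) = 1} :=
    isClosed_eq (continuous_charNorm.comp
      (continuous_subtype_val.mul continuous_const)) continuous_const
  have := (PadicInt.denseRange_natCast (p := p)).closure_range ▸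
    closure_minimal (by rintro _ ⟨n, rfl⟩; simpa using hnat n) hcl
  exact this (Set.mem_univ (⟨z, hz⟩ : ℤ_[p]))

omit [BorelSpace ℚ_[p]] in
/-- On the set where its modulus is `1`, the characteristic function is that of a point mass. -/
theorem exists_ae_stdChar_mul_eq :
    ∃ x₀, ∀ᵐ x ∂μ, ∀ y, charNorm μ y = 1 →
      Padic.stdChar p (y * x) = Padic.stdChar p (y * x₀) := by
  obtain ⟨D, hDs, hDc, hD⟩ := (TopologicalSpace.IsSeparable.of_separableSpace
    {y : ℚ_[p] | charNorm μ y = 1}).exists_countable_dense_subset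
  choose! c hc using fun y (hy : y ∈ D) => charNorm_eq_one_iff.1 (hDs hy)
  have h : ∀ᵐ x ∂μ, ∀ y ∈ D, Padic.stdChar p (y * x) = c y := (ae_ball_iff hDc).2 hc
  obtain ⟨x₀, hx₀⟩ := h.exists
  refine ⟨x₀, ?_⟩
  filter_upwards [h] with x hx y hy
  have hcl : IsClosed {y : ℚ_[p] | Padic.stdChar p (y * x) = Padic.stdChar p (y * x₀)} :=
    isClosed_eq (Padic.continuous_stdChar.comp (continuous_mul_const x))
      (Padic.continuous_stdChar.comp (continuous_mul_const x₀))
  exact closure_minimal (fun y hy => (hx y hy).trans (hx₀ y hy).symm) hcl (hD hy)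

omit [BorelSpace ℚ_[p]] in
theorem mem_degenerateDistributions_of_charNorm (h : ∀ y, charNorm μ y = 1) :
    μ ∈ degenerateDistributions ℚ_[p] := by
  obtain ⟨x₀, hx₀⟩ := exists_ae_stdChar_mul_eq (μ := μ)
  have hae : (id : ℚ_[p] → ℚ_[p]) =ᵐ[μ] fun _ => x₀ := by
    filter_upwards [hx₀] with x hx
    refine sub_eq_zero.1 (Padic.eq_zero_of_stdChar_mul_eq_one fun y => ?_)
    rw [id, mul_sub, AddChar.map_sub_eq_div, hx y (h y), div_self']
  refine ⟨x₀, ?_⟩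
  rw [← Measure.map_id (μ := μ), Measure.map_congr hae, Measure.map_const]
  simp

omit [IsProbabilityMeasure μ] in
/-- The characteristic function of the normalized Haar measure of `K` vanishes off the annihilator
of `K`. -/
theorem integral_stdChar_addHaar_eq_zero {K : AddSubgroup ℚ_[p]} {m : Measure K}
    [m.IsAddHaarMeasure] {y k : ℚ_[p]} (hk : k ∈ K)
    (hy : Padic.stdChar p (y * k) ≠ 1) : ∫ x : K, (Padic.stdChar p (y * x) : ℂ) ∂m = 0 := by
  have h := integral_add_left_eq_self (μ := m) (fun x : K => (Padic.stdChar p (y * x) : ℂ)) ⟨k, hk⟩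
  simp only [AddSubgroup.coe_add, mul_add, AddChar.map_add_eq_mul, Circle.coe_mul] at h
  rw [integral_const_mul] at h
  by_contra h0
  exact hy (Circle.ext (by simpa using (mul_eq_right₀ h0).1 h))

/-- In the nontrivial direction `μ` is compared with a shift of the Haar distribution of the
annihilator `K` of the set where the modulus is `1`: both characteristic functions agree on that
set and vanish off it. -/
theorem mem_idempotentDistributions_iff :
    μ ∈ idempotentDistributions ℚ_[p] ↔ ∀ y, charNorm μ y = 0 ∨ charNorm μ y = 1 := by
  have hmeas : ∀ (K : AddSubgroup ℚ_[p]) (x₀ : ℚ_[p]), Measurable fun k : K => x₀ + (k : ℚ_[p]) :=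
    fun K x₀ => measurable_subtype_coe.const_add x₀
  have hint : ∀ (K : AddSubgroup ℚ_[p]) (m : Measure K) (x₀ y : ℚ_[p]),
      ∫ x, (Padic.stdChar p (y * x) : ℂ) ∂(m.map fun k : K => x₀ + (k : ℚ_[p])) =
        Padic.stdChar p (y * x₀) * ∫ x : K, (Padic.stdChar p (y * x) : ℂ) ∂m := by
    intro K m x₀ y
    rw [integral_map (hmeas K x₀).aemeasurable
      (Padic.measurable_stdChar_mul y).aestronglyMeasurable, ← integral_const_mul]
    simp only [mul_add, AddChar.map_add_eq_mul, Circle.coe_mul]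
  constructor
  · rintro ⟨K, m, x₀, -, hm, hm1, rfl⟩ y
    unfold charNorm
    rw [hint]
    by_cases h : ∀ k ∈ K, Padic.stdChar p (y * k) = 1
    · right
      simpa [h] using Padic.norm_coe_stdChar (y * x₀)
    · left
      push Not at h
      obtain ⟨k, hk, hy⟩ := h
      simp [integral_stdChar_addHaar_eq_zero hk hy]
  · intro h
    obtain ⟨x₀, hx₀⟩ := exists_ae_stdChar_mul_eq (μ := μ)
    let K : AddSubgroup ℚ_[p] :=
      { carrier := {x | ∀ y, charNorm μ y = 1 → Padic.stdChar p (y * x) = 1}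
        zero_mem' := fun y _ => by simp
        add_mem' := fun {a b} ha hb y hy => by
          rw [mul_add, AddChar.map_add_eq_mul, ha y hy, hb y hy, one_mul]
        neg_mem' := fun {a} ha y hy => by
          rw [mul_neg, AddChar.map_neg_eq_inv, ha y hy, inv_one] }
    have hKmem : ∀ x, x ∈ K ↔ ∀ y, charNorm μ y = 1 → Padic.stdChar p (y * x) = 1 :=
      fun _ => Iff.rfl
    have hp0 : (p : ℚ_[p]) ≠ 0 := by exact_mod_cast (Fact.out : p.Prime).ne_zero
    have hp1 : (1 : ℝ) < p := by exact_mod_cast (Fact.out : p.Prime).one_lt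
    -- the modulus does not vanish near the origin, so it equals `1` at some nonzero point
    obtain ⟨y₀, hy₀, hy₀ne⟩ : ∃ y, charNorm μ y = 1 ∧ y ≠ 0 := by
      have h1 : ∀ᶠ y in nhdsWithin (0 : ℚ_[p]) {0}ᶜ, charNorm μ y ≠ 0 :=
        (continuous_charNorm.continuousAt.eventually_ne
          (by rw [charNorm_zero]; exact one_ne_zero)).filter_mono nhdsWithin_le_nhds
      obtain ⟨y, hy, hy'⟩ := (h1.and self_mem_nhdsWithin).exists
      exact ⟨y, (h y).resolve_left hy, hy'⟩
    have hKcomp : IsCompact (K : Set ℚ_[p]) := by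
      refine Metric.isCompact_of_isClosed_isBounded ?_ ?_
      · have : (K : Set ℚ_[p]) = ⋂ y, ⋂ (_ : charNorm μ y = 1), 
            {x | Padic.stdChar p (y * x) = 1} := by
          ext x; simp [hKmem]
        rw [this]
        exact isClosed_iInter fun y => isClosed_iInter fun _ =>
          isClosed_eq (Padic.continuous_stdChar.comp (continuous_const_mul y)) continuous_const
      · refine (Metric.isBounded_closedBall (x := (0 : ℚ_[p])) (r := p / ‖y₀‖)).subset
          fun x hx => ?_
        rw [mem_closedBall_zero_iff]
        by_contra! hlt
        have hy₀' : 0 < ‖y₀‖ := norm_pos_iff.2 hy₀ne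
        have hx0 : 0 < ‖x‖ := lt_trans (by positivity) hlt
        have hx0' : x ≠ 0 := norm_pos_iff.1 hx0
        rw [div_lt_iff₀ hy₀'] at hlt
        refine Padic.stdChar_inv_ne_one (p := p) ?_
        have h2 := hx ((p : ℚ_[p])⁻¹ * (y₀ * x)⁻¹ * y₀) (charNorm_mul_eq_one hy₀ ?_)
        · rwa [show (p : ℚ_[p])⁻¹ * (y₀ * x)⁻¹ * y₀ * x = (p : ℚ_[p])⁻¹ by field_simp] at h2
        · rw [norm_mul, norm_inv, norm_inv, Padic.norm_p, inv_inv, norm_mul, ← div_eq_mul_inv,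
            div_le_one (by positivity)]
          linarith
    have : CompactSpace K := isCompact_iff_compactSpace.1 hKcomp
    let m : Measure K := Measure.addHaarMeasure ⊤
    have : IsProbabilityMeasure m :=
      ⟨by simpa using Measure.addHaarMeasure_self (K₀ := (⊤ : TopologicalSpace.PositiveCompacts K))⟩
    have : IsProbabilityMeasure (m.map fun k : K => x₀ + (k : ℚ_[p])) :=
      Measure.isProbabilityMeasure_map (hmeas K x₀).aemeasurable
    refine ⟨K, m, x₀, hKcomp, inferInstance, inferInstance,
      Padic.measure_ext_of_integral_stdChar fun y => ?_⟩
    rw [hint]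
    rcases h y with hy | hy
    · -- `y` lies outside the annihilator of `K`: the point `(p y)⁻¹` belongs to `K`
      have hy0 : y ≠ 0 := by
        rintro rfl
        rw [charNorm_zero] at hy
        exact one_ne_zero hy
      have hmem : (p : ℚ_[p])⁻¹ * y⁻¹ ∈ K := by
        intro e he
        refine Padic.stdChar_eq_one ?_
        have hlt : ‖e‖ < ‖y‖ := by
          by_contra! hle
          have he0 : e ≠ 0 := by
            rintro rfl
            exact hy0 (by simpa using hle)
          have h3 := charNorm_mul_eq_one (z := y * e⁻¹) he (by
            rw [norm_mul, norm_inv, ← div_eq_mul_inv]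
            exact div_le_one_of_le₀ hle (norm_nonneg _))
          rw [inv_mul_cancel_right₀ he0, hy] at h3
          exact zero_ne_one h3
        have h4 : ‖e * y⁻¹‖ < 1 := by
          rw [norm_mul, norm_inv, ← div_eq_mul_inv]
          exact (div_lt_one (norm_pos_iff.2 hy0)).2 hlt
        rw [mul_left_comm, norm_mul, norm_inv, Padic.norm_p, inv_inv]
        calc (p : ℝ) * ‖e * y⁻¹‖ ≤ p * (p : ℝ)⁻¹ :=
              mul_le_mul_of_nonneg_left (Padic.norm_le_inv_of_norm_lt_one h4) (by positivity)
          _ = 1 := mul_inv_cancel₀ (by positivity)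
      rw [integral_stdChar_addHaar_eq_zero hmem, mul_zero]
      · exact norm_eq_zero.1 hy
      · rw [mul_left_comm, mul_inv_cancel₀ hy0, mul_one]
        exact Padic.stdChar_inv_ne_one
    · have h1 : ∫ x, (Padic.stdChar p (y * x) : ℂ) ∂μ = Padic.stdChar p (y * x₀) := by
        have : ∫ x, (Padic.stdChar p (y * x) : ℂ) ∂μ = ∫ _, (Padic.stdChar p (y * x₀) : ℂ) ∂μ := by
          refine integral_congr_ae ?_
          filter_upwards [hx₀] with x hx
          rw [hx y hy]
        simpa using this
      have h2 : ∀ k : K, Padic.stdChar p (y * k) = 1 := fun k => k.2 y hy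
      simp [h1, h2]

theorem degenerateDistributions_subset_idempotentDistributions :
    degenerateDistributions ℚ_[p] ⊆ idempotentDistributions ℚ_[p] := by
  rintro _ ⟨x, rfl⟩
  refine mem_idempotentDistributions_iff.2 fun y => Or.inr ?_
  rw [charNorm, integral_dirac]
  exact Padic.norm_coe_stdChar _

end charNorm

/-! ### The functional equation for independent linear forms -/

section functionalEquation

variable {p : ℕ} [Fact p.Prime] [MeasurableSpace ℚ_[p]] [BorelSpace ℚ_[p]]

theorem ProbabilityTheory.iIndepFun.integral_stdChar_sum {ι Ω : Type*} [Fintype ι]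
    [MeasurableSpace Ω] {P : Measure Ω} {ξ : ι → Ω → ℚ_[p]} (hm : ∀ j, Measurable (ξ j))
    (hξ : iIndepFun ξ P) (a : ι → ℚ_[p]) :
    ∫ ω, (Padic.stdChar p (∑ j, a j * ξ j ω) : ℂ) ∂P =
      ∏ j, ∫ x, (Padic.stdChar p (a j * x) : ℂ) ∂(P.map (ξ j)) := by
  have h := hξ.integral_fun_prod_comp (fun j => (hm j).aemeasurable)
    (f := fun j x => (Padic.stdChar p (a j * x) : ℂ))
    (fun j => (Padic.measurable_stdChar_mul (a j)).aestronglyMeasurable)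
  have hprod : ∀ ω, (Padic.stdChar p (∑ j, a j * ξ j ω) : ℂ) =
      ∏ j, (Padic.stdChar p (a j * ξ j ω) : ℂ) := by
    intro ω
    exact map_prod (Circle.coeHom.comp (Padic.stdChar p).toMonoidHom)
      (fun j => Multiplicative.ofAdd (a j * ξ j ω)) Finset.univ
  simp only [hprod]
  rw [h]
  refine Finset.prod_congr rfl fun j _ => ?_
  rw [integral_map (hm j).aemeasurable (Padic.measurable_stdChar_mul (a j)).aestronglyMeasurable]

/-- Independence of the components of `Λ ξ` as an equation between characteristic functions,
restricted to the coordinate axes after inverting `Λ`. -/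
theorem charNorm_eq_prod_of_iIndepFun_mulVec {ι Ω : Type*} [Fintype ι] [DecidableEq ι]
    [MeasurableSpace Ω] {P : Measure Ω} [IsProbabilityMeasure P] {ξ : ι → Ω → ℚ_[p]}
    (hm : ∀ j, Measurable (ξ j)) (hξ : iIndepFun ξ P) {Λ N : Matrix ι ι ℚ_[p]} (hN : N * Λ = 1)
    (hL : iIndepFun (fun i ω => Λ.mulVec (fun j => ξ j ω) i) P) (j : ι) (s : ℚ_[p]) :
    charNorm (P.map (ξ j)) s =
      ∏ i, ∏ j', charNorm (P.map (ξ j')) (Λ i j' * (N j i * s)) := by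
  have hLm : ∀ i, Measurable fun ω => Λ.mulVec (fun j => ξ j ω) i := fun i => by
    simp only [Matrix.mulVec, dotProduct]
    fun_prop
  have h1 := hL.integral_stdChar_sum hLm (fun i => N j i * s)
  have h2 : ∀ i, ∫ x, (Padic.stdChar p (N j i * s * x) : ℂ)
      ∂(P.map fun ω => Λ.mulVec (fun j => ξ j ω) i) =
      ∏ j', ∫ x, (Padic.stdChar p (Λ i j' * (N j i * s) * x) : ℂ) ∂(P.map (ξ j')) := by
    intro i
    rw [← hξ.integral_stdChar_sum hm, integral_map (hLm i).aemeasurable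
      (Padic.measurable_stdChar_mul _).aestronglyMeasurable]
    simp only [Matrix.mulVec, dotProduct, Finset.mul_sum]
    simp only [mul_left_comm, mul_assoc]
  have h3 : ∀ ω, ∑ i, N j i * s * Λ.mulVec (fun j => ξ j ω) i = s * ξ j ω := by
    intro ω
    have : (N.mulVec (Λ.mulVec fun j => ξ j ω)) j = ξ j ω := by
      rw [Matrix.mulVec_mulVec, hN, Matrix.one_mulVec]
    rw [← this]
    conv_rhs => rw [Matrix.mulVec, dotProduct, Finset.mul_sum]
    refine Finset.sum_congr rfl fun i _ => by ring
  simp only [h2, h3] at h1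
  unfold charNorm
  rw [integral_map (hm j).aemeasurable (Padic.measurable_stdChar_mul _).aestronglyMeasurable, h1,
    norm_prod]
  simp only [norm_prod]

variable {ι : Type*} [Fintype ι] [DecidableEq ι] {μ : ι → Measure ℚ_[p]}
  [∀ j, IsProbabilityMeasure (μ j)] {Λ N : Matrix ι ι ℚ_[p]}

omit [BorelSpace ℚ_[p]] [DecidableEq ι] in
theorem charNorm_le_row
    (heq : ∀ j s, charNorm (μ j) s = ∏ i, ∏ j', charNorm (μ j') (Λ i j' * (N j i * s)))
    (i j : ι) (s : ℚ_[p]) :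
    charNorm (μ j) s ≤ ∏ j', charNorm (μ j') (Λ i j' * (N j i * s)) := by
  classical
  rw [heq, ← Finset.mul_prod_erase _ _ (Finset.mem_univ i)]
  exact mul_le_of_le_one_right (Finset.prod_nonneg fun _ _ => charNorm_nonneg _)
    (Finset.prod_le_one (fun _ _ => Finset.prod_nonneg fun _ _ => charNorm_nonneg _)
      fun _ _ => Finset.prod_le_one (fun _ _ => charNorm_nonneg _) fun _ _ => charNorm_le_one _)

omit [BorelSpace ℚ_[p]] [DecidableEq ι] in
theorem charNorm_le_entry
    (heq : ∀ j s, charNorm (μ j) s = ∏ i, ∏ j', charNorm (μ j') (Λ i j' * (N j i * s)))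
    (i j j' : ι) (s : ℚ_[p]) :
    charNorm (μ j) s ≤ charNorm (μ j') (Λ i j' * (N j i * s)) := by
  classical
  refine (charNorm_le_row heq i j s).trans ?_
  rw [← Finset.mul_prod_erase _ _ (Finset.mem_univ j')]
  exact mul_le_of_le_one_right (charNorm_nonneg _)
    (Finset.prod_le_one (fun _ _ => charNorm_nonneg _) fun _ _ => charNorm_le_one _)

omit [BorelSpace ℚ_[p]] [DecidableEq ι] in
theorem charNorm_le_two_entries
    (heq : ∀ j s, charNorm (μ j) s = ∏ i, ∏ j', charNorm (μ j') (Λ i j' * (N j i * s)))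
    (i j : ι) {j' : ι} (hj' : j' ≠ j) (s : ℚ_[p]) :
    charNorm (μ j) s ≤
      charNorm (μ j) (Λ i j * (N j i * s)) * charNorm (μ j') (Λ i j' * (N j i * s)) := by
  classical
  refine (charNorm_le_row heq i j s).trans ?_
  rw [← Finset.mul_prod_erase _ _ (Finset.mem_univ j),
    ← Finset.mul_prod_erase _ _ (Finset.mem_erase.2 ⟨hj', Finset.mem_univ j'⟩), ← mul_assoc]
  exact mul_le_of_le_one_right (mul_nonneg (charNorm_nonneg _) (charNorm_nonneg _))
    (Finset.prod_le_one (fun _ _ => charNorm_nonneg _) fun _ _ => charNorm_le_one _)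

/-! ### Degenerate distributions -/

omit [DecidableEq ι] in
/-- If `c = Λ i j * N j i` has norm greater than `1`, then `|φ_j (s)| ≥ |φ_j (c⁻ⁿ s)| → 1`,
and this spreads from `j` to the other indices along row `i`. -/
theorem charNorm_eq_one_of_one_lt_norm
    (heq : ∀ j s, charNorm (μ j) s = ∏ i, ∏ j', charNorm (μ j') (Λ i j' * (N j i * s)))
    {i j : ι} (hc : 1 < ‖Λ i j * N j i‖) (hΛ : ∀ j', Λ i j' ≠ 0) (j' : ι) (y : ℚ_[p]) :
    charNorm (μ j') y = 1 := by
  set c := Λ i j * N j i with hcdef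
  have hc0 : c ≠ 0 := norm_pos_iff.1 (zero_lt_one.trans hc)
  have hN0 : N j i ≠ 0 := right_ne_zero_of_mul hc0
  have hj : ∀ s, charNorm (μ j) s = 1 := by
    intro s
    have hstep : ∀ n : ℕ, charNorm (μ j) (c⁻¹ ^ n * s) ≤ charNorm (μ j) s := by
      intro n
      induction n with
      | zero => simp
      | succ n ih =>
        refine le_trans ?_ ih
        have h1 := charNorm_le_entry heq i j j (c⁻¹ * (c⁻¹ ^ n * s))
        rwa [← mul_assoc (Λ i j), ← hcdef, mul_inv_cancel_left₀ hc0, ← mul_assoc, ← pow_succ'] at h1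
    have hlim : Filter.Tendsto (fun n : ℕ => charNorm (μ j) (c⁻¹ ^ n * s)) Filter.atTop
        (nhds 1) := by
      have h0 : Filter.Tendsto (fun n : ℕ => c⁻¹ ^ n * s) Filter.atTop (nhds 0) := by
        simpa using (tendsto_pow_atTop_nhds_zero_of_norm_lt_one (x := c⁻¹)
          (by rw [norm_inv]; exact inv_lt_one_of_one_lt₀ hc)).mul_const s
      have := (continuous_charNorm (μ := μ j)).continuousAt.tendsto.comp h0
      rwa [charNorm_zero] at this
    exact le_antisymm (charNorm_le_one s) (le_of_tendsto' hlim hstep)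
  refine le_antisymm (charNorm_le_one y) ?_
  have h := charNorm_le_entry heq i j j' ((N j i)⁻¹ * ((Λ i j')⁻¹ * y))
  rwa [hj, mul_inv_cancel_left₀ hN0, mul_inv_cancel_left₀ (hΛ j')] at h

theorem IndependenceForces.degenerate_of_one_lt_norm {Λ N : Matrix (Fin 3) (Fin 3) ℚ_[p]}
    (hN : N * Λ = 1) {i j : Fin 3} (hc : 1 < ‖Λ i j * N j i‖) (hΛ : ∀ j', Λ i j' ≠ 0) :
    IndependenceForces.{u} Λ (degenerateDistributions ℚ_[p]) := by
  intro Ω _ P _ ξ hm hξ hL j'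
  have : ∀ j, IsProbabilityMeasure (P.map (ξ j)) := fun j =>
    Measure.isProbabilityMeasure_map (hm j).aemeasurable
  exact mem_degenerateDistributions_of_charNorm fun y =>
    charNorm_eq_one_of_one_lt_norm
      (fun j s => charNorm_eq_prod_of_iIndepFun_mulVec hm hξ hN hL j s) hc hΛ j' y

/-! ### Idempotent distributions -/

/-- Every row and every column of a matrix over `ℚ_[p]` has at least two entries of norm `1`:
for each row and each position in it there is an entry of norm `1` elsewhere in the row, and
likewise for columns. -/
def TwoUnitsInLines (Λ : Matrix (Fin 3) (Fin 3) ℚ_[p]) : Prop :=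
  (∀ i j, ∃ j', j' ≠ j ∧ ‖Λ i j'‖ = 1) ∧ ∀ i j, ∃ i', i' ≠ i ∧ ‖Λ i' j‖ = 1

omit [MeasurableSpace ℚ_[p]] [BorelSpace ℚ_[p]] in
theorem Padic.norm_sum_lt_one {ι : Type*} (s : Finset ι) {f : ι → ℚ_[p]}
    (h : ∀ i ∈ s, ‖f i‖ < 1) : ‖∑ i ∈ s, f i‖ < 1 := by
  classical
  induction s using Finset.induction_on with
  | empty => simp
  | insert a s ha ih =>
    rw [Finset.sum_insert ha]
    exact (Padic.nonarchimedean _ _).trans_lt (max_lt (h a (by simp))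
      (ih fun i hi => h i (by simp [hi])))

omit [MeasurableSpace ℚ_[p]] [BorelSpace ℚ_[p]] [DecidableEq ι] in
theorem Matrix.exists_norm_mul_eq_one [DecidableEq ι] {A B : Matrix ι ι ℚ_[p]} (h : A * B = 1)
    (hA : ∀ i j, ‖A i j‖ ≤ 1) (hB : ∀ i j, ‖B i j‖ ≤ 1) (a : ι) :
    ∃ b, ‖A a b‖ = 1 ∧ ‖B b a‖ = 1 := by
  by_contra! hcon
  have hs : ∑ b, A a b * B b a = 1 := by
    rw [← Matrix.mul_apply, h, Matrix.one_apply_eq]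
  have := Padic.norm_sum_lt_one Finset.univ (f := fun b => A a b * B b a) fun b _ => by
    rw [norm_mul]
    by_cases hb : ‖A a b‖ = 1
    · rw [hb, one_mul]
      exact lt_of_le_of_ne (hB _ _) (hcon b hb)
    · exact (mul_le_of_le_one_right (norm_nonneg _) (hB _ _)).trans_lt
        (lt_of_le_of_ne (hA _ _) hb)
  rw [hs, norm_one] at this
  exact lt_irrefl _ this

omit [MeasurableSpace ℚ_[p]] [BorelSpace ℚ_[p]] in
/-- A strong connectedness statement: under `TwoUnitsInLines Λ`, the only nonempty set of
indices closed under `j ↦ j'` whenever `N j i` and `Λ i j'` are units for some `i`, is the set of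
all indices. If the index `j₁` were missing, then the two rows of `N` in the set would, modulo
the maximal ideal, be supported at the same single position, so `N` would be singular there. -/
theorem TwoUnitsInLines.eq_univ_of_closed {Λ N : Matrix (Fin 3) (Fin 3) ℚ_[p]}
    (h : TwoUnitsInLines Λ) (hΛ : ∀ i j, ‖Λ i j‖ ≤ 1) (hN : ∀ i j, ‖N i j‖ ≤ 1) (hNΛ : N * Λ = 1)
    {S : Set (Fin 3)} {j₀ : Fin 3} (hj₀ : j₀ ∈ S)
    (hS : ∀ j ∈ S, ∀ i j', ‖N j i‖ = 1 → ‖Λ i j'‖ = 1 → j' ∈ S) (j₁ : Fin 3) : j₁ ∈ S := by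
  by_contra hj₁
  have hrow : ∀ j, ∃ i, ‖N j i‖ = 1 ∧ ‖Λ i j‖ = 1 := Matrix.exists_norm_mul_eq_one hNΛ hN hΛ
  obtain ⟨i, hi, -⟩ := hrow j₀
  obtain ⟨j₂, hj₂, hij₂⟩ := h.1 i j₀
  have hj₂S : j₂ ∈ S := hS j₀ hj₀ i j₂ hi hij₂
  obtain ⟨i₁, -, hi₁⟩ := h.2 0 j₁
  obtain ⟨i₂, hi₂₁, hi₂⟩ := h.2 i₁ j₁
  have hsmall : ∀ j ∈ S, ∀ i, ‖Λ i j₁‖ = 1 → ‖N j i‖ < 1 := fun j hj i hi =>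
    lt_of_le_of_ne (hN j i) fun hc => hj₁ (hS j hj i j₁ hc hi)
  -- in the rows `j₀` and `j₂` of `N` a unit can stand only at the remaining position `i₃`
  obtain ⟨i₃, h3, h3'⟩ := hrow j₀
  obtain ⟨i₄, h4, h4'⟩ := hrow j₂
  have hne : ∀ j ∈ S, ∀ i, ‖N j i‖ = 1 → i ≠ i₁ ∧ i ≠ i₂ := by
    intro j hj i hi
    constructor
    · rintro rfl
      exact (hsmall j hj _ hi₁).ne hi
    · rintro rfl
      exact (hsmall j hj _ hi₂).ne hi
  have e3 := hne j₀ hj₀ i₃ h3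
  have e4 := hne j₂ hj₂S i₄ h4
  obtain rfl : i₃ = i₄ := by omega
  have hzero : ∑ b, N j₂ b * Λ b j₀ = 0 := by
    rw [← Matrix.mul_apply, hNΛ, Matrix.one_apply_ne hj₂]
  rw [← Finset.add_sum_erase _ _ (Finset.mem_univ i₃), add_eq_zero_iff_eq_neg] at hzero
  have hlt := Padic.norm_sum_lt_one (Finset.univ.erase i₃) (f := fun b => N j₂ b * Λ b j₀)
    fun b hb => by
      rw [norm_mul]
      refine (mul_le_of_le_one_right (norm_nonneg _) (hΛ _ _)).trans_lt ?_
      have hb3 : b ≠ i₃ := (Finset.mem_erase.1 hb).1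
      have : b = i₁ ∨ b = i₂ := by omega
      rcases this with rfl | rfl
      · exact hsmall j₂ hj₂S _ hi₁
      · exact hsmall j₂ hj₂S _ hi₂
  rw [← norm_neg, ← hzero, norm_mul, h4, h3', one_mul] at hlt
  exact lt_irrefl _ hlt

theorem charNorm_eq_zero_or_one {μ : Fin 3 → Measure ℚ_[p]} [∀ j, IsProbabilityMeasure (μ j)]
    {Λ N : Matrix (Fin 3) (Fin 3) ℚ_[p]} (h : TwoUnitsInLines Λ) (hΛ : ∀ i j, ‖Λ i j‖ ≤ 1)
    (hN : ∀ i j, ‖N i j‖ ≤ 1) (hNΛ : N * Λ = 1)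
    (heq : ∀ j s, charNorm (μ j) s = ∏ i, ∏ j', charNorm (μ j') (Λ i j' * (N j i * s)))
    (j : Fin 3) (y : ℚ_[p]) : charNorm (μ j) y = 0 ∨ charNorm (μ j) y = 1 := by
  by_cases hy : y = 0
  · right
    rw [hy, charNorm_zero]
  rw [or_iff_not_imp_left]
  intro hne
  have hy' : 0 < ‖y‖ := norm_pos_iff.2 hy
  -- one nonzero value on the sphere `‖s‖ = ‖y‖` produces the value `1` there for another index
  let S : Set (Fin 3) := {j | ∀ s, ‖s‖ = ‖y‖ → charNorm (μ j) s = 1}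
  have hmem : ∀ j s, ‖s‖ = ‖y‖ → charNorm (μ j) s = 1 → j ∈ S := by
    intro j s hs h1 t ht
    have hs0 : s ≠ 0 := norm_pos_iff.1 (hs ▸ hy')
    have := charNorm_mul_eq_one (z := t * s⁻¹) h1 (by
      rw [norm_mul, norm_inv, hs, ht, mul_inv_cancel₀ hy'.ne'])
    rwa [inv_mul_cancel_right₀ hs0] at this
  have hclosed : ∀ j ∈ S, ∀ i j', ‖N j i‖ = 1 → ‖Λ i j'‖ = 1 → j' ∈ S := by
    intro j hj i j' h1 h2
    refine hmem j' (Λ i j' * (N j i * y)) (by rw [norm_mul, norm_mul, h1, h2, one_mul, one_mul]) ?_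
    refine le_antisymm (charNorm_le_one _) ?_
    rw [← hj y rfl]
    exact charNorm_le_entry heq i j j' y
  obtain ⟨j₀, hj₀⟩ : ∃ j₀, j₀ ∈ S := by
    obtain ⟨s, hs, hmax⟩ := (isCompact_sphere (0 : ℚ_[p]) ‖y‖).exists_isMaxOn ⟨y, by simp⟩
      (continuous_charNorm (μ := μ j)).continuousOn
    have hsn : ‖s‖ = ‖y‖ := by simpa using hs
    have hpos : 0 < charNorm (μ j) s :=
      ((charNorm_nonneg y).lt_of_ne (Ne.symm hne)).trans_le (hmax (by simp))
    obtain ⟨i, hi, hi'⟩ := Matrix.exists_norm_mul_eq_one hNΛ hN hΛ j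
    obtain ⟨j', hj', hij'⟩ := h.1 i j
    refine ⟨j', hmem j' (Λ i j' * (N j i * s)) (by
      rw [norm_mul, norm_mul, hi, hij', one_mul, one_mul, hsn]) ?_⟩
    refine le_antisymm (charNorm_le_one _) ?_
    have h1 := charNorm_le_two_entries heq i j hj' s
    have h2 : charNorm (μ j) (Λ i j * (N j i * s)) ≤ charNorm (μ j) s :=
      hmax (by simp [hi, hi', hsn])
    have h3 := h1.trans (mul_le_mul_of_nonneg_right h2 (charNorm_nonneg _))
    exact le_of_mul_le_mul_left (by simpa using h3) hpos
  exact h.eq_univ_of_closed hΛ hN hNΛ hj₀ hclosed j y rfl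

theorem IndependenceForces.idempotent_of_twoUnitsInLines {Λ N : Matrix (Fin 3) (Fin 3) ℚ_[p]}
    (h : TwoUnitsInLines Λ) (hΛ : ∀ i j, ‖Λ i j‖ ≤ 1) (hN : ∀ i j, ‖N i j‖ ≤ 1)
    (hNΛ : N * Λ = 1) :
    IndependenceForces.{u} Λ (idempotentDistributions ℚ_[p]) := by
  intro Ω _ P _ ξ hm hξ hL j
  have : ∀ j, IsProbabilityMeasure (P.map (ξ j)) := fun j =>
    Measure.isProbabilityMeasure_map (hm j).aemeasurable
  exact mem_idempotentDistributions_iff.2 fun y =>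
    charNorm_eq_zero_or_one h hΛ hN hNΛ
      (fun j s => charNorm_eq_prod_of_iIndepFun_mulVec hm hξ hNΛ hL j s) j y

end functionalEquation

/-! ### Independence without idempotence -/

section counterexample

variable {p : ℕ} [Fact p.Prime] [MeasurableSpace ℚ_[p]] [BorelSpace ℚ_[p]]

/-- To refute `IndependenceForces Λ C` it suffices to find a product measure outside `C` which `Λ`
carries to a product measure. The sample space is lifted to the required universe. -/
theorem IndependenceForces.mem_of_map_pi {Λ : Matrix (Fin 3) (Fin 3) ℚ_[p]}
    {C : Set (Measure ℚ_[p])} (h : IndependenceForces.{u} Λ C) {μ ν : Fin 3 → Measure ℚ_[p]}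
    [∀ j, IsProbabilityMeasure (μ j)] [∀ j, IsProbabilityMeasure (ν j)]
    (hmap : (Measure.pi μ).map (fun x => Λ.mulVec x) = Measure.pi ν) (j : Fin 3) : μ j ∈ C := by
  let P : Measure (ULift.{u} (Fin 3 → ℚ_[p])) := (Measure.pi μ).map MeasurableEquiv.ulift.symm
  have hPdown : P.map (fun ω => ω.down) = Measure.pi μ := by
    have : (fun ω : ULift.{u} (Fin 3 → ℚ_[p]) => ω.down) = MeasurableEquiv.ulift := rfl
    rw [this, MeasurableEquiv.map_map_symm]
  have hdown : Measurable fun ω : ULift.{u} (Fin 3 → ℚ_[p]) => ω.down := measurable_down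
  have hP : IsProbabilityMeasure P :=
    Measure.isProbabilityMeasure_map MeasurableEquiv.ulift.symm.measurable.aemeasurable
  have hΛ : Measurable fun x : Fin 3 → ℚ_[p] => Λ.mulVec x := by
    refine measurable_pi_lambda _ fun i => ?_
    simp only [Matrix.mulVec, dotProduct]
    fun_prop
  have hcoord : ∀ j, P.map (fun ω => ω.down j) = μ j := by
    intro j
    have h1 := Measure.map_map (μ := P) (measurable_pi_apply j) hdown
    rw [hPdown] at h1
    have h2 := Measure.pi_map_eval μ j
    simp only [measure_univ, Finset.prod_const_one, one_smul] at h2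
    exact h1.symm.trans h2
  have hcoordL : ∀ i, P.map (fun ω => Λ.mulVec (fun j => ω.down j) i) = ν i := by
    intro i
    have h1 := Measure.map_map (μ := P) (measurable_pi_apply i) (hΛ.comp hdown)
    rw [← Measure.map_map hΛ hdown, hPdown, hmap] at h1
    have h2 := Measure.pi_map_eval ν i
    simp only [measure_univ, Finset.prod_const_one, one_smul] at h2
    exact h1.symm.trans h2
  have hm : ∀ j, Measurable fun ω : ULift.{u} (Fin 3 → ℚ_[p]) => ω.down j :=
    fun j => (measurable_pi_apply j).comp hdown
  rw [← hcoord j]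
  refine h _ P (fun j ω => ω.down j) hm ?_ ?_ j
  · rw [iIndepFun_iff_map_fun_eq_pi_map fun j => (hm j).aemeasurable]
    simp only [hcoord]
    exact hPdown
  · have hLm : ∀ i, Measurable fun ω : ULift.{u} (Fin 3 → ℚ_[p]) =>
        Λ.mulVec (fun j => ω.down j) i := fun i => (measurable_pi_apply i).comp (hΛ.comp hdown)
    rw [iIndepFun_iff_map_fun_eq_pi_map fun i => (hLm i).aemeasurable]
    simp only [hcoordL]
    rw [← hmap, ← hPdown, Measure.map_map hΛ hdown]
    rfl

/-- The uniform distribution on the ball of radius `R` about the origin. -/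
noncomputable def unifBall (p : ℕ) [Fact p.Prime] [MeasurableSpace ℚ_[p]] [BorelSpace ℚ_[p]]
    (R : ℝ) : Measure ℚ_[p] :=
  (Measure.addHaar : Measure ℚ_[p])[|Metric.closedBall 0 R]

theorem addHaar_closedBall_ne_zero {R : ℝ} (hR : 0 < R) :
    (Measure.addHaar : Measure ℚ_[p]) (Metric.closedBall 0 R) ≠ 0 :=
  (Metric.measure_closedBall_pos _ _ hR).ne'

theorem addHaar_closedBall_ne_top (R : ℝ) :
    (Measure.addHaar : Measure ℚ_[p]) (Metric.closedBall 0 R) ≠ ⊤ :=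
  (isCompact_closedBall 0 R).measure_lt_top.ne

theorem isProbabilityMeasure_unifBall {R : ℝ} (hR : 0 < R) :
    IsProbabilityMeasure (unifBall p R) :=
  cond_isProbabilityMeasure_of_finite (addHaar_closedBall_ne_zero hR)
    (addHaar_closedBall_ne_top R)

theorem pi_unifBall {ι : Type*} [Fintype ι] {R : ι → ℝ} (hR : ∀ a, 0 < R a) :
    Measure.pi (fun a => unifBall p (R a)) =
      (Measure.pi fun _ : ι => (Measure.addHaar : Measure ℚ_[p]))[|
        Set.univ.pi fun a => Metric.closedBall 0 (R a)] := by
  have := fun a => isProbabilityMeasure_unifBall (p := p) (hR a)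
  refine Measure.pi_eq fun s hs => ?_
  rw [cond_apply (MeasurableSet.univ_pi fun a => Metric.isClosed_closedBall.measurableSet),
    ← Set.pi_inter_distrib, Measure.pi_pi, Measure.pi_pi, ENNReal.prod_inv_distrib,
    ← Finset.prod_mul_distrib]
  · refine Finset.prod_congr rfl fun a _ => ?_
    rw [unifBall, cond_apply Metric.isClosed_closedBall.measurableSet]
  · exact fun a _ b _ _ => Or.inl (addHaar_closedBall_ne_zero (hR a))

/-- A linear automorphism which carries one box onto another carries the uniform distribution on
the first one to that on the second one, by uniqueness of Haar measure. -/
theorem map_mulVec_pi_unifBall {ι : Type*} [Fintype ι] [DecidableEq ι] {Λ N : Matrix ι ι ℚ_[p]}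
    (hNΛ : N * Λ = 1) {R R' : ι → ℝ} (hR : ∀ a, 0 < R a) (hR' : ∀ a, 0 < R' a)
    (h : ∀ a b, ‖Λ a b‖ * R b ≤ R' a) (h' : ∀ a b, ‖N a b‖ * R' b ≤ R a) :
    (Measure.pi fun a => unifBall p (R a)).map (fun x => Λ.mulVec x) =
      Measure.pi fun a => unifBall p (R' a) := by
  have hΛN : Λ * N = 1 := mul_eq_one_comm.1 hNΛ
  have hcont : ∀ M : Matrix ι ι ℚ_[p], Continuous fun x : ι → ℚ_[p] => M.mulVec x := fun M =>
    continuous_const.matrix_mulVec continuous_id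
  let e : (ι → ℚ_[p]) ≃+ (ι → ℚ_[p]) :=
    { toFun := fun x => Λ.mulVec x
      invFun := fun x => N.mulVec x
      left_inv := fun x => by simp [hNΛ]
      right_inv := fun x => by simp [hΛN]
      map_add' := fun x y => Matrix.mulVec_add _ _ _ }
  have hbox : ∀ (M : Matrix ι ι ℚ_[p]) (r r' : ι → ℝ), (∀ a, 0 < r a) → (∀ a, 0 < r' a) →
      (∀ a b, ‖M a b‖ * r b ≤ r' a) →
      ∀ x ∈ Set.univ.pi fun a => Metric.closedBall (0 : ℚ_[p]) (r a),
      M.mulVec x ∈ Set.univ.pi fun a => Metric.closedBall (0 : ℚ_[p]) (r' a) := by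
    intro M r r' hr hr' hM x hx a _
    rw [mem_closedBall_zero_iff]
    refine IsUltrametricDist.norm_sum_le_of_forall_le_of_nonneg (hr' a).le fun b _ => ?_
    rw [norm_mul]
    refine le_trans (mul_le_mul_of_nonneg_left ?_ (norm_nonneg _)) (hM a b)
    simpa using hx b (Set.mem_univ b)
  set π : Measure (ι → ℚ_[p]) := Measure.pi fun _ => Measure.addHaar with hπ
  have hH : (π.map e).IsAddHaarMeasure :=
    e.isAddHaarMeasure_map π (hcont Λ) (hcont N)
  obtain ⟨c, hc⟩ : ∃ c : NNReal, π.map e = c • π :=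
    ⟨_, Measure.isAddLeftInvariant_eq_smul (π.map e) π⟩
  have hmeasB : ∀ r : ι → ℝ,
      MeasurableSet (Set.univ.pi fun a => Metric.closedBall (0 : ℚ_[p]) (r a)) :=
    fun r => MeasurableSet.univ_pi fun a => Metric.isClosed_closedBall.measurableSet
  have hpre : (fun x => Λ.mulVec x) ⁻¹'
      (Set.univ.pi fun a => Metric.closedBall (0 : ℚ_[p]) (R' a)) =
      Set.univ.pi fun a => Metric.closedBall (0 : ℚ_[p]) (R a) := by
    ext x
    refine ⟨fun hx => ?_, hbox Λ R R' hR hR' h x⟩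
    have := hbox N R' R hR' hR h' _ hx
    rwa [Matrix.mulVec_mulVec, hNΛ, Matrix.one_mulVec] at this
  have hmap : ∀ A, MeasurableSet A → π ((fun x => Λ.mulVec x) ⁻¹' A) = c * π A := by
    intro A hA
    have h1 : π.map (fun x => Λ.mulVec x) = c • π := hc
    rw [← Measure.map_apply (hcont Λ).measurable hA, h1]
    rfl
  have hc0 : c ≠ 0 := by
    rintro rfl
    have h1 := hmap Set.univ MeasurableSet.univ
    simp only [Set.preimage_univ, ENNReal.coe_zero, zero_mul] at h1
    exact (isOpen_univ.measure_pos π Set.univ_nonempty).ne' h1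
  rw [pi_unifBall hR, pi_unifBall hR']
  ext A hA
  rw [Measure.map_apply (hcont Λ).measurable hA, cond_apply (hmeasB R), cond_apply (hmeasB R'),
    ← hpre, ← Set.preimage_inter, hmap _ (hmeasB R'), hmap _ ((hmeasB R').inter hA),
    ENNReal.mul_inv (Or.inl (by exact_mod_cast hc0)) (Or.inl ENNReal.coe_ne_top),
    mul_mul_mul_comm, ENNReal.inv_mul_cancel (by exact_mod_cast hc0) ENNReal.coe_ne_top, one_mul]

/-- The equal mixture of the uniform distributions on `ℤ_[p]` and on `p ℤ_[p]`. -/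
noncomputable def unifMixture (p : ℕ) [Fact p.Prime] [MeasurableSpace ℚ_[p]]
    [BorelSpace ℚ_[p]] : Measure ℚ_[p] :=
  (2 : ENNReal)⁻¹ • unifBall p 1 + (2 : ENNReal)⁻¹ • unifBall p (p : ℝ)⁻¹

omit [MeasurableSpace ℚ_[p]] [BorelSpace ℚ_[p]] in
theorem inv_prime_pos : 0 < (p : ℝ)⁻¹ :=
  inv_pos.2 (by exact_mod_cast (Fact.out : p.Prime).pos)

theorem isProbabilityMeasure_unifMixture : IsProbabilityMeasure (unifMixture p) := by
  have := isProbabilityMeasure_unifBall (p := p) one_pos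
  have := isProbabilityMeasure_unifBall (p := p) (inv_prime_pos (p := p))
  refine ⟨?_⟩
  simp [unifMixture, ENNReal.inv_two_add_inv_two]

/-- At `p⁻¹` the characteristic function of `unifMixture` is `(0 + 1) / 2`. -/
theorem unifMixture_notMem_idempotentDistributions :
    unifMixture p ∉ idempotentDistributions ℚ_[p] := by
  have h1 := isProbabilityMeasure_unifBall (p := p) one_pos
  have h2 := isProbabilityMeasure_unifBall (p := p) (inv_prime_pos (p := p))
  have := isProbabilityMeasure_unifMixture (p := p)
  have hp0 : (p : ℝ) ≠ 0 := by exact_mod_cast (Fact.out : p.Prime).ne_zero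
  have i1 : ∫ x, (Padic.stdChar p ((p : ℚ_[p])⁻¹ * x) : ℂ) ∂(unifBall p 1) = 0 := by
    -- translation by `1` preserves `ℤ_[p]` and multiplies the integrand by `χ (p⁻¹) ≠ 1`
    let f : ℚ_[p] → ℂ := (Metric.closedBall (0 : ℚ_[p]) 1).indicator
      fun x => (Padic.stdChar p ((p : ℚ_[p])⁻¹ * x) : ℂ)
    have hf : ∀ x, f (1 + x) = Padic.stdChar p (p : ℚ_[p])⁻¹ * f x := by
      intro x
      have hiff : 1 + x ∈ Metric.closedBall (0 : ℚ_[p]) 1 ↔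
          x ∈ Metric.closedBall (0 : ℚ_[p]) 1 := by
        rw [mem_closedBall_zero_iff, mem_closedBall_zero_iff]
        exact AddSubgroup.add_mem_cancel_left (PadicInt.subring p).toAddSubgroup
          (PadicInt.subring p).one_mem
      by_cases hx : x ∈ Metric.closedBall (0 : ℚ_[p]) 1
      · simp only [f]
        rw [Set.indicator_of_mem hx, Set.indicator_of_mem (hiff.2 hx), mul_add, mul_one,
          AddChar.map_add_eq_mul, Circle.coe_mul]
      · simp only [f]
        rw [Set.indicator_of_notMem hx, Set.indicator_of_notMem (mt hiff.1 hx), mul_zero]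
    have hi := integral_add_left_eq_self (μ := (Measure.addHaar : Measure ℚ_[p])) f 1
    simp only [hf] at hi
    rw [integral_const_mul] at hi
    have h0 : ∫ x, f x ∂(Measure.addHaar : Measure ℚ_[p]) = 0 := by
      by_contra h0
      exact Padic.stdChar_inv_ne_one (Circle.ext (by simpa using (mul_eq_right₀ h0).1 hi))
    rw [unifBall, ProbabilityTheory.cond, integral_smul_measure,
      ← integral_indicator Metric.isClosed_closedBall.measurableSet, h0, smul_zero]
  have i2 : ∫ x, (Padic.stdChar p ((p : ℚ_[p])⁻¹ * x) : ℂ) ∂(unifBall p (p : ℝ)⁻¹) = 1 := by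
    have : ∀ᵐ x ∂(unifBall p (p : ℝ)⁻¹), (Padic.stdChar p ((p : ℚ_[p])⁻¹ * x) : ℂ) = 1 := by
      refine Measure.ae_smul_measure (ae_restrict_of_forall_mem
        Metric.isClosed_closedBall.measurableSet fun x hx => ?_) _
      rw [Padic.stdChar_eq_one, Circle.coe_one]
      rw [mem_closedBall_zero_iff] at hx
      rw [norm_mul, norm_inv, Padic.norm_p, inv_inv]
      calc (p : ℝ) * ‖x‖ ≤ p * (p : ℝ)⁻¹ := by gcongr
        _ = 1 := mul_inv_cancel₀ hp0
    rw [integral_congr_ae this]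
    simp
  have hval : charNorm (unifMixture p) (p : ℚ_[p])⁻¹ = 1 / 2 := by
    unfold charNorm unifMixture
    rw [integral_add_measure ((Padic.integrable_stdChar_mul _).smul_measure (by simp))
      ((Padic.integrable_stdChar_mul _).smul_measure (by simp)), integral_smul_measure,
      integral_smul_measure, i1, i2]
    simp
  intro h
  have := mem_idempotentDistributions_iff.1 h (p : ℚ_[p])⁻¹
  rw [hval] at this
  norm_num at this

omit [BorelSpace ℚ_[p]] in
theorem pi_ite_half_add_half {ι : Type*} [Fintype ι] [DecidableEq ι] (j : ι)
    (μ ν ρ : Measure ℚ_[p]) [IsProbabilityMeasure μ] [IsProbabilityMeasure ν]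
    [IsProbabilityMeasure ρ] :
    Measure.pi (fun a => if a = j then (2 : ENNReal)⁻¹ • μ + (2 : ENNReal)⁻¹ • ν else ρ) =
      (2 : ENNReal)⁻¹ • Measure.pi (fun a => if a = j then μ else ρ) +
        (2 : ENNReal)⁻¹ • Measure.pi (fun a => if a = j then ν else ρ) := by
  have hsf : ∀ (τ : Measure ℚ_[p]) [IsFiniteMeasure τ] (a : ι),
      IsFiniteMeasure (if a = j then τ else ρ) := by
    intro τ _ a
    split_ifs <;> infer_instance
  have hfin : IsFiniteMeasure ((2 : ENNReal)⁻¹ • μ + (2 : ENNReal)⁻¹ • ν) :=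
    ⟨by simp [ENNReal.inv_two_add_inv_two]⟩
  have h1 := hsf μ
  have h2 := hsf ν
  have h3 := hsf ((2 : ENNReal)⁻¹ • μ + (2 : ENNReal)⁻¹ • ν)
  have hsplit : ∀ (τ : Measure ℚ_[p]) (s : ι → Set ℚ_[p]),
      ∏ a, (if a = j then τ else ρ) (s a) = τ (s j) * ∏ a ∈ Finset.univ.erase j, ρ (s a) := by
    intro τ s
    rw [← Finset.mul_prod_erase _ _ (Finset.mem_univ j), if_pos rfl]
    congr 1
    exact Finset.prod_congr rfl fun a ha => by rw [if_neg (Finset.ne_of_mem_erase ha)]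
  refine Measure.pi_eq fun s hs => ?_
  rw [hsplit, Measure.add_apply, Measure.smul_apply, Measure.smul_apply, Measure.pi_pi,
    Measure.pi_pi, hsplit, hsplit, Measure.add_apply, Measure.smul_apply, Measure.smul_apply]
  simp only [smul_eq_mul]
  ring

/-- If a matrix invertible over `ℤ_[p]` has a row or a column (given by `hline`) all of whose
entries except that at `(i, j)` are divisible by `p`, then `ξ j` may have the distribution
`unifMixture`: let the remaining two variables be uniform on `ℤ_[p]` or on `p ℤ_[p]`
respectively. Both boxes obtained by restricting `ξ j` to `ℤ_[p]` or `p ℤ_[p]` are then carried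
by `Λ` onto boxes which differ in the `i`-th factor only. -/
theorem not_independenceForces_of_line {Λ N : Matrix (Fin 3) (Fin 3) ℚ_[p]} (hNΛ : N * Λ = 1)
    (hΛ : ∀ i j, ‖Λ i j‖ ≤ 1) (hN : ∀ i j, ‖N i j‖ ≤ 1) {i j : Fin 3}
    (hline : (∀ j', j' ≠ j → ‖Λ i j'‖ < 1) ∨ ∀ i', i' ≠ i → ‖Λ i' j‖ < 1) :
    ¬ IndependenceForces.{u} Λ (idempotentDistributions ℚ_[p]) := by
  intro hF
  have hΛN : Λ * N = 1 := mul_eq_one_comm.1 hNΛ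
  have hp1 : (p : ℝ)⁻¹ < 1 := inv_lt_one_of_one_lt₀ (by exact_mod_cast (Fact.out : p.Prime).one_lt)
  have hp0 : 0 < (p : ℝ)⁻¹ := inv_prime_pos
  have hle : ∀ x : ℚ_[p], ‖x‖ < 1 → ‖x‖ ≤ (p : ℝ)⁻¹ := fun x =>
    Padic.norm_le_inv_of_norm_lt_one
  -- the inverse has the same shape, with the position `(i, j)` replaced by `(j, i)`
  have hline' : ((∀ j', j' ≠ j → ‖Λ i j'‖ < 1) ∧ ∀ i', i' ≠ i → ‖N j i'‖ < 1) ∨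
      ((∀ i', i' ≠ i → ‖Λ i' j‖ < 1) ∧ ∀ j', j' ≠ j → ‖N j' i‖ < 1) := by
    refine hline.imp (fun h => ⟨h, ?_⟩) fun h => ⟨h, ?_⟩
    · obtain ⟨b, hb, -⟩ := Matrix.exists_norm_mul_eq_one hΛN hΛ hN i
      obtain rfl : b = j := by
        by_contra hbj
        exact (h b hbj).ne hb
      intro i' hi'
      have hz : ∑ a, Λ i a * N a i' = 0 := by
        rw [← Matrix.mul_apply, hΛN, Matrix.one_apply_ne hi'.symm]
      rw [← Finset.add_sum_erase _ _ (Finset.mem_univ b), add_eq_zero_iff_eq_neg] at hz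
      have hlt := Padic.norm_sum_lt_one (Finset.univ.erase b) (f := fun a => Λ i a * N a i')
        fun a ha => by
          rw [norm_mul]
          exact (mul_le_of_le_one_right (norm_nonneg _) (hN _ _)).trans_lt
            (h a (Finset.ne_of_mem_erase ha))
      rwa [← norm_neg, ← hz, norm_mul, hb, one_mul] at hlt
    · obtain ⟨b, -, hb⟩ := Matrix.exists_norm_mul_eq_one hNΛ hN hΛ j
      obtain rfl : b = i := by
        by_contra hbi
        exact (h b hbi).ne hb
      intro j' hj'
      have hz : ∑ a, N j' a * Λ a j = 0 := by
        rw [← Matrix.mul_apply, hNΛ, Matrix.one_apply_ne hj']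
      rw [← Finset.add_sum_erase _ _ (Finset.mem_univ b), add_eq_zero_iff_eq_neg] at hz
      have hlt := Padic.norm_sum_lt_one (Finset.univ.erase b) (f := fun a => N j' a * Λ a j)
        fun a ha => by
          rw [norm_mul]
          exact (mul_le_of_le_one_left (norm_nonneg _) (hN _ _)).trans_lt
            (h a (Finset.ne_of_mem_erase ha))
      rwa [← norm_neg, ← hz, norm_mul, hb, mul_one] at hlt
  obtain ⟨r, hr0, hr⟩ : ∃ r : ℝ, 0 < r ∧ ∀ t : ℝ, (p : ℝ)⁻¹ ≤ t → t ≤ 1 →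
      (Measure.pi fun a => if a = j then unifBall p t else unifBall p r).map
        (fun x => Λ.mulVec x) =
      Measure.pi fun a => if a = i then unifBall p t else unifBall p r := by
    have hgen : ∀ r t : ℝ, 0 < r → 0 < t → r ≤ 1 →
        (∀ b, b ≠ j → ‖Λ i b‖ * r ≤ t) → (∀ a, a ≠ i → ‖Λ a j‖ * t ≤ r) →
        (∀ b, b ≠ i → ‖N j b‖ * r ≤ t) → (∀ a, a ≠ j → ‖N a i‖ * t ≤ r) →
        (Measure.pi fun a => if a = j then unifBall p t else unifBall p r).map
          (fun x => Λ.mulVec x) =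
        Measure.pi fun a => if a = i then unifBall p t else unifBall p r := by
      intro r t hr ht hr1 h1 h2 h3 h4
      have hpos : ∀ k a : Fin 3, 0 < if a = k then t else r := by
        intro k a
        split_ifs <;> assumption
      have := map_mulVec_pi_unifBall hNΛ (hpos j) (hpos i) ?_ ?_
      · simpa only [apply_ite (unifBall p)] using this
      · intro a b
        split_ifs with hb ha ha
        · exact mul_le_of_le_one_left ht.le (hΛ _ _)
        · exact hb ▸ h2 a ha
        · exact ha ▸ h1 b hb
        · exact mul_le_of_le_one_left hr.le (hΛ _ _)
      · intro a b
        split_ifs with hb ha ha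
        · exact mul_le_of_le_one_left ht.le (hN _ _)
        · exact hb ▸ h4 a ha
        · exact ha ▸ h3 b hb
        · exact mul_le_of_le_one_left hr.le (hN _ _)
    have hmul : ∀ {x : ℚ_[p]} {t : ℝ}, t ≤ 1 → ‖x‖ < 1 → ‖x‖ * t ≤ (p : ℝ)⁻¹ :=
      fun {x t} ht hx => (mul_le_of_le_one_right (norm_nonneg x) ht).trans (hle x hx)
    rcases hline' with ⟨h, h'⟩ | ⟨h, h'⟩
    · refine ⟨1, one_pos, fun t ht ht1 => hgen 1 t one_pos (hp0.trans_le ht) le_rfl ?_ ?_ ?_ ?_⟩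
      · exact fun b hb => (hmul le_rfl (h b hb)).trans ht
      · exact fun a _ => mul_le_one₀ (hΛ _ _) (hp0.trans_le ht).le ht1
      · exact fun b hb => (hmul le_rfl (h' b hb)).trans ht
      · exact fun a _ => mul_le_one₀ (hN _ _) (hp0.trans_le ht).le ht1
    · refine ⟨(p : ℝ)⁻¹, hp0, fun t ht ht1 => hgen _ t hp0 (hp0.trans_le ht) hp1.le ?_ ?_ ?_ ?_⟩
      · exact fun b _ => (mul_le_of_le_one_left hp0.le (hΛ _ _)).trans ht
      · exact fun a ha => hmul ht1 (h a ha)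
      · exact fun b _ => (mul_le_of_le_one_left hp0.le (hN _ _)).trans ht
      · exact fun a ha => hmul ht1 (h' a ha)
  have hprob1 := isProbabilityMeasure_unifBall (p := p) one_pos
  have hprob2 := isProbabilityMeasure_unifBall (p := p) (inv_prime_pos (p := p))
  have hprobr := isProbabilityMeasure_unifBall (p := p) hr0
  have hprobm := isProbabilityMeasure_unifMixture (p := p)
  have hprob : ∀ k a : Fin 3,
      IsProbabilityMeasure (if a = k then unifMixture p else unifBall p r) := by
    intro k a
    split_ifs <;> assumption
  have hprobj := hprob j
  have hprobi := hprob i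
  have hΛm : Measurable fun x : Fin 3 → ℚ_[p] => Λ.mulVec x :=
    (continuous_const.matrix_mulVec continuous_id).measurable
  have hmap : (Measure.pi fun a => if a = j then unifMixture p else unifBall p r).map
      (fun x => Λ.mulVec x) =
      Measure.pi fun a => if a = i then unifMixture p else unifBall p r := by
    simp only [unifMixture]
    rw [pi_ite_half_add_half, pi_ite_half_add_half, Measure.map_add _ _ hΛm, Measure.map_smul,
      Measure.map_smul, hr 1 hp1.le le_rfl, hr _ le_rfl hp1.le]
  have := hF.mem_of_map_pi hmap j
  rw [if_pos rfl] at this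
  exact unifMixture_notMem_idempotentDistributions this

/-- For a matrix invertible over `ℤ_[p]`, only idempotent distributions are possible if and only
if every row and every column contains at least two units. -/
theorem independenceForces_idempotent_iff {Λ N : Matrix (Fin 3) (Fin 3) ℚ_[p]} (hNΛ : N * Λ = 1)
    (hΛ : ∀ i j, ‖Λ i j‖ ≤ 1) (hN : ∀ i j, ‖N i j‖ ≤ 1) :
    IndependenceForces.{u} Λ (idempotentDistributions ℚ_[p]) ↔ TwoUnitsInLines Λ := by
  refine ⟨fun h => ⟨?_, ?_⟩, fun h => .idempotent_of_twoUnitsInLines h hΛ hN hNΛ⟩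
  · by_contra! hcon
    obtain ⟨i, j, hij⟩ := hcon
    exact not_independenceForces_of_line hNΛ hΛ hN
      (Or.inl fun j' hj' => lt_of_le_of_ne (hΛ _ _) (hij j' hj')) h
  · by_contra! hcon
    obtain ⟨i, j, hij⟩ := hcon
    exact not_independenceForces_of_line hNΛ hΛ hN
      (Or.inr fun i' hi' => lt_of_le_of_ne (hΛ _ _) (hij i' hi')) h

/-! ### Rescaling of forms and variables -/

theorem IndependenceForces.idempotent_of_diagonal {Λ : Matrix (Fin 3) (Fin 3) ℚ_[p]}
    {a b : Fin 3 → ℚ_[p]} (hb : ∀ j, b j ≠ 0)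
    (h : IndependenceForces.{u} (Matrix.of fun i j => a i * Λ i j * b j)
      (idempotentDistributions ℚ_[p])) :
    IndependenceForces.{u} Λ (idempotentDistributions ℚ_[p]) := by
  intro Ω _ P _ ξ hm hξ hL j
  have hm' : ∀ j, Measurable fun ω => (b j)⁻¹ * ξ j ω := fun j => (hm j).const_mul _
  have h1 := h Ω P (fun j ω => (b j)⁻¹ * ξ j ω) hm'
    (hξ.comp (fun j x => (b j)⁻¹ * x) fun j => measurable_const_mul _) ?_ j
  · have hp1 : IsProbabilityMeasure (P.map (ξ j)) :=
      Measure.isProbabilityMeasure_map (hm j).aemeasurable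
    have hp2 : IsProbabilityMeasure (P.map fun ω => (b j)⁻¹ * ξ j ω) :=
      Measure.isProbabilityMeasure_map (hm' j).aemeasurable
    rw [mem_idempotentDistributions_iff] at h1 ⊢
    intro y
    have h2 : P.map (fun ω => (b j)⁻¹ * ξ j ω) = (P.map (ξ j)).map ((b j)⁻¹ * ·) :=
      (Measure.map_map (measurable_const_mul _) (hm j)).symm
    have h3 := h1 (y * b j)
    rwa [h2, charNorm_map_const_mul, mul_inv_cancel_right₀ (hb j)] at h3
  · convert hL.comp (fun i x => a i * x) (fun i => measurable_const_mul _) using 2 with i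
    ext ω
    simp only [Matrix.mulVec, dotProduct, Matrix.of_apply, Function.comp_apply, Finset.mul_sum]
    refine Finset.sum_congr rfl fun j _ => ?_
    have := hb j
    field_simp

theorem independenceForces_idempotent_diagonal_iff {Λ : Matrix (Fin 3) (Fin 3) ℚ_[p]}
    {a b : Fin 3 → ℚ_[p]} (ha : ∀ i, a i ≠ 0) (hb : ∀ j, b j ≠ 0) :
    IndependenceForces.{u} (Matrix.of fun i j => a i * Λ i j * b j)
      (idempotentDistributions ℚ_[p]) ↔
    IndependenceForces.{u} Λ (idempotentDistributions ℚ_[p]) := by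
  refine ⟨.idempotent_of_diagonal hb, fun h => ?_⟩
  refine .idempotent_of_diagonal (a := fun i => (a i)⁻¹) (b := fun j => (b j)⁻¹)
    (fun j => inv_ne_zero (hb j)) ?_
  convert h using 1
  ext i j
  have := ha i
  have := hb j
  simp only [Matrix.of_apply]
  field_simp

end counterexample

/-! ### Matrices over the `p`-adic integers -/

section integral

variable {p : ℕ} [Fact p.Prime]

theorem mem_padicUnits_iff {x : ℚ_[p]} : x ∈ padicUnits p ↔ ‖x‖ = 1 := by
  constructor
  · rintro ⟨u, rfl⟩
    exact PadicInt.isUnit_iff.1 u.isUnit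
  · intro h
    let z : ℤ_[p] := ⟨x, h.le⟩
    obtain ⟨u, hu⟩ := (PadicInt.isUnit_iff (z := z)).2 h
    exact ⟨u, congrArg Subtype.val hu⟩

theorem norm_prime_pow_mul_unit (n : ℕ) (u : ℤ_[p]ˣ) :
    ‖(p : ℚ_[p]) ^ n * ((u : ℤ_[p]) : ℚ_[p])‖ = (p : ℝ)⁻¹ ^ n := by
  rw [norm_mul, norm_pow, Padic.norm_p, mem_padicUnits_iff.1 ⟨u, rfl⟩, mul_one]

theorem Matrix.exists_padicInt_map {n : Type*} {M : Matrix n n ℚ_[p]} (hM : ∀ i j, ‖M i j‖ ≤ 1) :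
    ∃ A : Matrix n n ℤ_[p], M = A.map PadicInt.Coe.ringHom :=
  ⟨Matrix.of fun i j => ⟨M i j, hM i j⟩, rfl⟩

theorem Matrix.norm_det_le_one {n : Type*} [Fintype n] [DecidableEq n] {M : Matrix n n ℚ_[p]}
    (hM : ∀ i j, ‖M i j‖ ≤ 1) : ‖M.det‖ ≤ 1 := by
  obtain ⟨A, rfl⟩ := Matrix.exists_padicInt_map hM
  have h := RingHom.map_det (PadicInt.Coe.ringHom (p := p)) A
  rw [RingHom.mapMatrix_apply] at h
  rw [← h]
  exact A.det.2

theorem Matrix.exists_integral_leftInverse {n : Type*} [Fintype n] [DecidableEq n]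
    {M : Matrix n n ℚ_[p]} (hM : ∀ i j, ‖M i j‖ ≤ 1) (hdet : ‖M.det‖ = 1) :
    ∃ N : Matrix n n ℚ_[p], N * M = 1 ∧ ∀ i j, ‖N i j‖ ≤ 1 := by
  obtain ⟨A, rfl⟩ := Matrix.exists_padicInt_map hM
  have h := RingHom.map_det (PadicInt.Coe.ringHom (p := p)) A
  rw [RingHom.mapMatrix_apply] at h
  have hu : IsUnit A.det := PadicInt.isUnit_iff.2 (by rw [← h] at hdet; exact hdet)
  refine ⟨A⁻¹.map PadicInt.Coe.ringHom, ?_, fun i j => (A⁻¹ i j).2⟩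
  rw [← Matrix.map_mul, Matrix.nonsing_inv_mul _ hu,
    Matrix.map_one _ (map_zero _) (map_one _)]

theorem Set.two_le_ncard_iff_forall_exists_ne {α : Type*} [Finite α] [Nonempty α] {T : Set α} :
    2 ≤ T.ncard ↔ ∀ a, ∃ b, b ≠ a ∧ b ∈ T := by
  rw [Nat.succ_le_iff, Set.one_lt_ncard_iff]
  constructor
  · rintro ⟨b, c, hb, hc, hbc⟩ a
    by_cases h : b = a
    · exact ⟨c, fun h' => hbc (h.trans h'.symm), hc⟩
    · exact ⟨b, h, hb⟩
  · intro h
    obtain ⟨b, -, hb⟩ := h (Classical.arbitrary α)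
    obtain ⟨c, hcb, hc⟩ := h b
    exact ⟨b, c, hb, hc, hcb.symm⟩

theorem twoUnitsInLines_iff_ncard {Λ : Matrix (Fin 3) (Fin 3) ℚ_[p]} :
    TwoUnitsInLines Λ ↔ (∀ i, 2 ≤ {j | Λ i j ∈ padicUnits p}.ncard) ∧
      ∀ j, 2 ≤ {i | Λ i j ∈ padicUnits p}.ncard := by
  simp only [Set.two_le_ncard_iff_forall_exists_ne, Set.mem_ofPred_eq, mem_padicUnits_iff,
    TwoUnitsInLines]
  exact and_congr_right fun _ => forall_comm

/-! ### The two normalized matrices -/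

/-- The entries of `N` in row `0` and in column `0` are integral by `h`. As the first row and the
first column of `Lambda1` consist of ones, the row and column sums of `N` are integral, so the
other four entries agree up to sign modulo `ℤ_[p]`; the unit makes one of them integral. -/
theorem Lambda1_inverse_integral {δ₁ δ₂ ε₁ ε₂ : ℚ_[p]} {N : Matrix (Fin 3) (Fin 3) ℚ_[p]}
    (hNΛ : N * Lambda1 δ₁ δ₂ ε₁ ε₂ = 1)
    (h : ∀ i j, ‖Lambda1 δ₁ δ₂ ε₁ ε₂ i j * N j i‖ ≤ 1)
    (hu : ‖δ₁‖ = 1 ∨ ‖δ₂‖ = 1 ∨ ‖ε₁‖ = 1 ∨ ‖ε₂‖ = 1) (i j : Fin 3) : ‖N i j‖ ≤ 1 := by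
  have hΛN := mul_eq_one_comm.1 hNΛ
  have hrow : ∀ m, N 0 m + N 1 m + N 2 m = (1 : Matrix (Fin 3) (Fin 3) ℚ_[p]) 0 m := by
    intro m
    rw [← hΛN, Matrix.mul_apply, Fin.sum_univ_three]
    simp [Lambda1]
  have hcol : ∀ m, N m 0 + N m 1 + N m 2 = (1 : Matrix (Fin 3) (Fin 3) ℚ_[p]) m 0 := by
    intro m
    rw [← hNΛ, Matrix.mul_apply, Fin.sum_univ_three]
    simp [Lambda1]
  have r1 := hrow 1
  have r2 := hrow 2
  have c1 := hcol 1
  have c2 := hcol 2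
  simp only [ne_eq, Fin.reduceEq, not_false_eq_true, Matrix.one_apply_ne] at r1 r2 c1 c2
  have h00 := h 0 0
  have h01 := h 0 1
  have h02 := h 0 2
  have h10 := h 1 0
  have h20 := h 2 0
  have h11 := h 1 1
  have h12 := h 1 2
  have h21 := h 2 1
  have h22 := h 2 2
  simp only [Lambda1, Matrix.of_apply, Matrix.cons_val', Matrix.cons_val_zero, Matrix.cons_val_one,
    Matrix.cons_val, one_mul, norm_mul] at h00 h01 h02 h10 h20 h11 h12 h21 h22
  let O := PadicInt.subring p
  have hO : ∀ x : ℚ_[p], ‖x‖ ≤ 1 ↔ x ∈ O := fun _ => Iff.rfl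
  simp only [hO] at h00 h01 h02 h10 h20
  have hx : N 1 1 ∈ O := by
    rcases hu with hu | hu | hu | hu
    · rwa [hu, one_mul] at h11
    · rw [hu, one_mul, hO] at h12
      rw [show N 1 1 = -(N 0 1 + N 2 1) by linear_combination r1]
      exact O.neg_mem (O.add_mem h10 h12)
    · rw [hu, one_mul, hO] at h21
      rw [show N 1 1 = -(N 1 0 + N 1 2) by linear_combination c1]
      exact O.neg_mem (O.add_mem h01 h21)
    · rw [hu, one_mul, hO] at h22
      rw [show N 1 1 = N 2 2 - N 0 1 + N 2 0 by linear_combination r1 - c2]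
      exact O.add_mem (O.sub_mem h22 h10) h02
  have hy : N 2 1 ∈ O := by
    rw [show N 2 1 = -(N 0 1 + N 1 1) by linear_combination r1]
    exact O.neg_mem (O.add_mem h10 hx)
  have hz : N 1 2 ∈ O := by
    rw [show N 1 2 = -(N 1 0 + N 1 1) by linear_combination c1]
    exact O.neg_mem (O.add_mem h01 hx)
  have hw : N 2 2 ∈ O := by
    rw [show N 2 2 = -(N 2 0 + N 2 1) by linear_combination c2]
    exact O.neg_mem (O.add_mem h02 hy)
  rw [hO]
  fin_cases i <;> fin_cases j <;> assumption

/-- The five entries `1` of `Lambda2` make the corresponding entries of `N` integral, and the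
equations `N Λ = Λ N = 1` express the remaining entries through these. -/
theorem Lambda2_inverse_integral {δ₁ δ₂ ε₁ ε₂ : ℚ_[p]} {N : Matrix (Fin 3) (Fin 3) ℚ_[p]}
    (hNΛ : N * Lambda2 δ₁ δ₂ ε₁ ε₂ = 1)
    (h : ∀ i j, ‖Lambda2 δ₁ δ₂ ε₁ ε₂ i j * N j i‖ ≤ 1)
    (hδ₁ : ‖δ₁‖ ≤ 1) (hε₁ : ‖ε₁‖ ≤ 1) (i j : Fin 3) : ‖N i j‖ ≤ 1 := by
  have hΛN := mul_eq_one_comm.1 hNΛ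
  have hrow : ∀ m, N 0 m + N 1 m + N 2 m = (1 : Matrix (Fin 3) (Fin 3) ℚ_[p]) 0 m := by
    intro m
    rw [← hΛN, Matrix.mul_apply, Fin.sum_univ_three]
    simp [Lambda2]
  have hcol0 : N 1 0 + N 1 1 * δ₁ + N 1 2 = 0 := by
    have : (N * Lambda2 δ₁ δ₂ ε₁ ε₂) 1 0 = 0 := by rw [hNΛ]; simp
    rw [Matrix.mul_apply, Fin.sum_univ_three] at this
    simpa [Lambda2] using this
  have hcol1 : N 0 0 + N 0 1 + N 0 2 * ε₁ = 0 := by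
    have : (N * Lambda2 δ₁ δ₂ ε₁ ε₂) 0 1 = 0 := by rw [hNΛ]; simp
    rw [Matrix.mul_apply, Fin.sum_univ_three] at this
    simpa [Lambda2] using this
  have r1 := hrow 1
  have r2 := hrow 2
  simp only [ne_eq, Fin.reduceEq, not_false_eq_true, Matrix.one_apply_ne] at r1 r2
  have h00 := h 0 0
  have h01 := h 0 1
  have h02 := h 0 2
  have h11 := h 1 1
  have h20 := h 2 0
  simp only [Lambda2, Matrix.of_apply, Matrix.cons_val', Matrix.cons_val_zero, Matrix.cons_val_one,
    Matrix.cons_val, one_mul] at h00 h01 h02 h11 h20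
  let O := PadicInt.subring p
  have hO : ∀ x : ℚ_[p], ‖x‖ ≤ 1 ↔ x ∈ O := fun _ => Iff.rfl
  simp only [hO] at h00 h01 h02 h11 h20 hδ₁ hε₁
  have hx : N 1 2 ∈ O := by
    rw [show N 1 2 = -(N 1 0 + N 1 1 * δ₁) by linear_combination hcol0]
    exact O.neg_mem (O.add_mem h01 (O.mul_mem h11 hδ₁))
  have hy : N 2 2 ∈ O := by
    rw [show N 2 2 = -(N 0 2 + N 1 2) by linear_combination r2]
    exact O.neg_mem (O.add_mem h20 hx)
  have hz : N 0 1 ∈ O := by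
    rw [show N 0 1 = -(N 0 0 + N 0 2 * ε₁) by linear_combination hcol1]
    exact O.neg_mem (O.add_mem h00 (O.mul_mem h20 hε₁))
  have hw : N 2 1 ∈ O := by
    rw [show N 2 1 = -(N 0 1 + N 1 1) by linear_combination r1]
    exact O.neg_mem (O.add_mem hz h11)
  rw [hO]
  fin_cases i <;> fin_cases j <;> assumption

theorem norm_det_Lambda2_eq_one {δ₁ δ₂ ε₁ ε₂ : ℚ_[p]} (h1 : ‖δ₁‖ < 1) (h2 : ‖δ₂‖ < 1)
    (h3 : ‖ε₁‖ < 1) (h4 : ‖ε₂‖ < 1) : ‖(Lambda2 δ₁ δ₂ ε₁ ε₂).det‖ = 1 := by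
  have hd : (Lambda2 δ₁ δ₂ ε₁ ε₂).det = ((1 - δ₁) * ε₂ + (1 - ε₁) * δ₂ + δ₁ * ε₁) - 1 := by
    rw [Matrix.det_fin_three]
    simp [Lambda2]
    ring
  have hadd : ∀ x y : ℚ_[p], ‖x‖ < 1 → ‖y‖ < 1 → ‖x + y‖ < 1 := fun x y hx hy =>
    (Padic.nonarchimedean x y).trans_lt (max_lt hx hy)
  have hmul : ∀ x y : ℚ_[p], ‖x‖ ≤ 1 → ‖y‖ < 1 → ‖x * y‖ < 1 := fun x y hx hy => by
    rw [norm_mul]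
    exact (mul_le_of_le_one_left (norm_nonneg _) hx).trans_lt hy
  have hsub : ∀ x : ℚ_[p], ‖x‖ < 1 → ‖x - 1‖ = 1 := fun x hx => by
    rw [sub_eq_add_neg, Padic.add_eq_max_of_ne (by rw [norm_neg, norm_one]; exact hx.ne), norm_neg,
      norm_one, max_eq_right hx.le]
  rw [hd]
  refine hsub _ (hadd _ _ (hadd _ _ (hmul _ _ ?_ h4) (hmul _ _ ?_ h2)) (hmul _ _ h1.le h3))
  · rw [norm_sub_rev, hsub _ h1]
  · rw [norm_sub_rev, hsub _ h3]

/-- If `δ₁, δ₂, ε₁, ε₂` are divisible by `p`, the lower right `2 × 2` block of the adjugate of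
`Lambda1` consists of units. -/
theorem norm_det_mul_Lambda1_inverse {δ₁ δ₂ ε₁ ε₂ : ℚ_[p]} (h1 : ‖δ₁‖ < 1) (h2 : ‖δ₂‖ < 1)
    (h3 : ‖ε₁‖ < 1) (h4 : ‖ε₂‖ < 1) {N : Matrix (Fin 3) (Fin 3) ℚ_[p]}
    (hNΛ : N * Lambda1 δ₁ δ₂ ε₁ ε₂ = 1) {i j : Fin 3} (hi : i ≠ 0) (hj : j ≠ 0) :
    ‖(Lambda1 δ₁ δ₂ ε₁ ε₂).det‖ * ‖N i j‖ = 1 := by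
  have hsub : ∀ x : ℚ_[p], ‖x‖ < 1 → ‖x - 1‖ = 1 := fun x hx => by
    rw [sub_eq_add_neg, Padic.add_eq_max_of_ne (by rw [norm_neg, norm_one]; exact hx.ne), norm_neg,
      norm_one, max_eq_right hx.le]
  have hadj : (Lambda1 δ₁ δ₂ ε₁ ε₂).adjugate = (Lambda1 δ₁ δ₂ ε₁ ε₂).det • N := by
    have := congrArg (N * ·) (Matrix.mul_adjugate (Lambda1 δ₁ δ₂ ε₁ ε₂))
    simp only [← mul_assoc, hNΛ, one_mul] at this
    simpa using this
  have hij : (Lambda1 δ₁ δ₂ ε₁ ε₂).det * N i j = (Lambda1 δ₁ δ₂ ε₁ ε₂).adjugate i j := by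
    rw [hadj]; rfl
  have hsub' : ∀ x : ℚ_[p], ‖x‖ < 1 → ‖-x + 1‖ = 1 := fun x hx => by
    rw [← hsub x hx, ← norm_neg, neg_add, neg_neg, sub_eq_add_neg]
  rw [← norm_mul, hij, Matrix.adjugate_fin_three]
  fin_cases i <;> fin_cases j <;> first
    | exact absurd rfl hi
    | exact absurd rfl hj
    | simp [Lambda1, hsub _ h1, hsub' _ h2, hsub' _ h3, hsub _ h4]

theorem norm_det_Lambda1_le {δ₁ δ₂ ε₁ ε₂ : ℚ_[p]} {r : ℝ} (h1 : ‖δ₁‖ ≤ r) (h2 : ‖δ₂‖ ≤ r)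
    (h3 : ‖ε₁‖ ≤ r) (h4 : ‖ε₂‖ ≤ r) (hr : r ≤ 1) : ‖(Lambda1 δ₁ δ₂ ε₁ ε₂).det‖ ≤ r := by
  have hd : (Lambda1 δ₁ δ₂ ε₁ ε₂).det = (δ₁ - 1) * ε₂ + (1 - ε₁) * δ₂ + (ε₁ - δ₁) := by
    rw [Matrix.det_fin_three]
    simp [Lambda1]
    ring
  have hadd : ∀ (x y : ℚ_[p]) (t : ℝ), ‖x‖ ≤ t → ‖y‖ ≤ t → ‖x + y‖ ≤ t := fun x y t hx hy =>
    (Padic.nonarchimedean x y).trans (max_le hx hy)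
  have hsub : ∀ (x y : ℚ_[p]) (t : ℝ), ‖x‖ ≤ t → ‖y‖ ≤ t → ‖x - y‖ ≤ t := fun x y t hx hy => by
    rw [sub_eq_add_neg]
    exact hadd _ _ _ hx (by rwa [norm_neg])
  have hmul : ∀ x y : ℚ_[p], ‖x‖ ≤ 1 → ‖y‖ ≤ r → ‖x * y‖ ≤ r := fun x y hx hy => by
    rw [norm_mul]
    exact (mul_le_of_le_one_left (norm_nonneg _) hx).trans hy
  rw [hd]
  exact hadd _ _ _ (hadd _ _ _ (hmul _ _ (hsub _ _ _ (h1.trans hr) norm_one.le) h4)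
    (hmul _ _ (hsub _ _ _ norm_one.le (h3.trans hr)) h2)) (hsub _ _ _ h3 h1)

theorem twoUnitsInLines_bordered_iff {a b c d e : ℚ_[p]} (ha : ‖a‖ ≠ 1) :
    TwoUnitsInLines !![a, 1, 1; 1, b, c; 1, d, e] ↔
      (‖b‖ = 1 ∧ ‖e‖ = 1) ∨ (‖c‖ = 1 ∧ ‖d‖ = 1) := by
  simp only [TwoUnitsInLines, Fin.forall_fin_succ, Fin.exists_fin_succ]
  simp [ha]
  tauto

end integral

section rescaling

variable {p : ℕ} [Fact p.Prime] [MeasurableSpace ℚ_[p]] [BorelSpace ℚ_[p]]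

/-- Multiplying the last two forms by `x⁻¹` and the first variable by `x` turns `Lambda1` into a
matrix invertible over `ℤ_[p]`, provided that `x` has the norm of the determinant. -/
theorem independenceForces_idempotent_Lambda1_iff {δ₁ δ₂ ε₁ ε₂ x : ℚ_[p]} (hx0 : x ≠ 0)
    (hx1 : ‖x‖ < 1) (h1 : ‖δ₁‖ ≤ ‖x‖) (h2 : ‖δ₂‖ ≤ ‖x‖) (h3 : ‖ε₁‖ ≤ ‖x‖) (h4 : ‖ε₂‖ ≤ ‖x‖)
    (hdet : ‖(Lambda1 δ₁ δ₂ ε₁ ε₂).det‖ = ‖x‖) :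
    IndependenceForces.{u} (Lambda1 δ₁ δ₂ ε₁ ε₂) (idempotentDistributions ℚ_[p]) ↔
      (‖δ₁‖ = ‖x‖ ∧ ‖ε₂‖ = ‖x‖) ∨ (‖δ₂‖ = ‖x‖ ∧ ‖ε₁‖ = ‖x‖) := by
  have hxn : 0 < ‖x‖ := norm_pos_iff.2 hx0
  set M : Matrix (Fin 3) (Fin 3) ℚ_[p] :=
    !![x, 1, 1; 1, x⁻¹ * δ₁, x⁻¹ * δ₂; 1, x⁻¹ * ε₁, x⁻¹ * ε₂] with hM
  have hMeq : M = Matrix.of fun i j =>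
      (![1, x⁻¹, x⁻¹] : Fin 3 → ℚ_[p]) i * Lambda1 δ₁ δ₂ ε₁ ε₂ i j *
        (![x, 1, 1] : Fin 3 → ℚ_[p]) j := by
    ext i j
    fin_cases i <;> fin_cases j <;> simp [hM, Lambda1, hx0]
  have hMdet : M.det = x⁻¹ * (Lambda1 δ₁ δ₂ ε₁ ε₂).det := by
    rw [Matrix.det_fin_three, Matrix.det_fin_three]
    simp [hM, Lambda1]
    field_simp
  have hle : ∀ y : ℚ_[p], ‖y‖ ≤ ‖x‖ → ‖x⁻¹ * y‖ ≤ 1 := fun y hy => by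
    rw [norm_mul, norm_inv]
    exact inv_mul_le_one_of_le₀ hy hxn.le
  have hunit : ∀ y : ℚ_[p], ‖x⁻¹ * y‖ = 1 ↔ ‖y‖ = ‖x‖ := fun y => by
    rw [norm_mul, norm_inv, inv_mul_eq_one₀ hxn.ne', eq_comm]
  have hMle : ∀ i j, ‖M i j‖ ≤ 1 := by
    intro i j
    have e1 := hle _ h1
    have e2 := hle _ h2
    have e3 := hle _ h3
    have e4 := hle _ h4
    fin_cases i <;> fin_cases j <;>
      first | exact hx1.le | exact norm_one.le | assumption
  obtain ⟨N, hNM, hN⟩ := Matrix.exists_integral_leftInverse hMle (by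
    rw [hMdet, norm_mul, norm_inv, hdet, inv_mul_cancel₀ hxn.ne'])
  rw [← independenceForces_idempotent_diagonal_iff (Λ := Lambda1 δ₁ δ₂ ε₁ ε₂)
    (a := ![1, x⁻¹, x⁻¹]) (b := ![x, 1, 1]), ← hMeq, independenceForces_idempotent_iff hNM hMle hN,
    hM, twoUnitsInLines_bordered_iff hx1.ne]
  · simp only [hunit]
  · intro i
    fin_cases i <;> simp [hx0]
  · intro j
    fin_cases j <;> simp [hx0]

end rescaling

/-! ### The classification -/

theorem theorem1 (p : ℕ) [Fact p.Prime] [MeasurableSpace ℚ_[p]] [BorelSpace ℚ_[p]]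
    (δ₁ δ₂ ε₁ ε₂ : ℚ_[p]) (k₁ k₂ l₁ l₂ : ℕ) (c₁ c₂ d₁ d₂ : ℤ_[p]ˣ)
    (hδ₁ : δ₁ = (p : ℚ_[p]) ^ k₁ * ((c₁ : ℤ_[p]) : ℚ_[p]))
    (hδ₂ : δ₂ = (p : ℚ_[p]) ^ k₂ * ((c₂ : ℤ_[p]) : ℚ_[p]))
    (hε₁ : ε₁ = (p : ℚ_[p]) ^ l₁ * ((d₁ : ℤ_[p]) : ℚ_[p]))
    (hε₂ : ε₂ = (p : ℚ_[p]) ^ l₂ * ((d₂ : ℤ_[p]) : ℚ_[p]))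
    (k : ℕ) (hk : k = min (min k₁ k₂) (min l₁ l₂))
    (Λ : Matrix (Fin 3) (Fin 3) ℚ_[p])
    (hΛ : Λ = Lambda1 δ₁ δ₂ ε₁ ε₂ ∨ Λ = Lambda2 δ₁ δ₂ ε₁ ε₂)
    (q : ℕ) (lam : ℤ_[p]ˣ) (hdet : Λ.det = (p : ℚ_[p]) ^ q * ((lam : ℤ_[p]) : ℚ_[p])) :
    -- A
    (q = 0 →
      (IndependenceForces.{u} Λ (idempotentDistributions ℚ_[p]) ↔
        (∀ i, 2 ≤ {j | Λ i j ∈ padicUnits p}.ncard) ∧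
        (∀ j, 2 ≤ {i | Λ i j ∈ padicUnits p}.ncard))) ∧
    -- B
    (0 < q →
      -- B.1
      ((δ₁ ∈ padicUnits p ∨ δ₂ ∈ padicUnits p ∨ ε₁ ∈ padicUnits p ∨ ε₂ ∈ padicUnits p) →
        IndependenceForces.{u} Λ (degenerateDistributions ℚ_[p])) ∧
      -- B.2
      ((δ₁ ∉ padicUnits p ∧ δ₂ ∉ padicUnits p ∧ ε₁ ∉ padicUnits p ∧ ε₂ ∉ padicUnits p) →
        (IndependenceForces.{u} Λ (idempotentDistributions ℚ_[p]) ↔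
          k < q ∨ (q = k ∧ ((k₁ = k ∧ l₂ = k) ∨ (k₂ = k ∧ l₁ = k)))) ∧
        (k < q → IndependenceForces.{u} Λ (degenerateDistributions ℚ_[p])))) := by
  have hp0 : (0 : ℝ) < (p : ℝ)⁻¹ := inv_prime_pos
  have hp1 : (p : ℝ)⁻¹ < 1 :=
    inv_lt_one_of_one_lt₀ (by exact_mod_cast (Fact.out : p.Prime).one_lt)
  have nδ₁ : ‖δ₁‖ = (p : ℝ)⁻¹ ^ k₁ := by rw [hδ₁, norm_prime_pow_mul_unit]
  have nδ₂ : ‖δ₂‖ = (p : ℝ)⁻¹ ^ k₂ := by rw [hδ₂, norm_prime_pow_mul_unit]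
  have nε₁ : ‖ε₁‖ = (p : ℝ)⁻¹ ^ l₁ := by rw [hε₁, norm_prime_pow_mul_unit]
  have nε₂ : ‖ε₂‖ = (p : ℝ)⁻¹ ^ l₂ := by rw [hε₂, norm_prime_pow_mul_unit]
  have ndet : ‖Λ.det‖ = (p : ℝ)⁻¹ ^ q := by rw [hdet, norm_prime_pow_mul_unit]
  have hpow1 : ∀ n : ℕ, (p : ℝ)⁻¹ ^ n ≤ 1 := fun n => pow_le_one₀ hp0.le hp1.le
  have hpowle : ∀ {m n : ℕ}, m ≤ n → (p : ℝ)⁻¹ ^ n ≤ (p : ℝ)⁻¹ ^ m := fun h =>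
    pow_le_pow_of_le_one hp0.le hp1.le h
  have hpowlt : ∀ {m n : ℕ}, m < n → (p : ℝ)⁻¹ ^ n < (p : ℝ)⁻¹ ^ m := fun h =>
    pow_lt_pow_right_of_lt_one₀ hp0 hp1 h
  have hpowinj : ∀ {m n : ℕ}, (p : ℝ)⁻¹ ^ m = (p : ℝ)⁻¹ ^ n ↔ m = n :=
    pow_right_inj₀ hp0 hp1.ne
  have hne : ∀ (x : ℚ_[p]) (n : ℕ), ‖x‖ = (p : ℝ)⁻¹ ^ n → x ≠ 0 := fun x n h =>
    norm_pos_iff.1 (h ▸ pow_pos hp0 n)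
  have δ₁le : ‖δ₁‖ ≤ 1 := nδ₁ ▸ hpow1 _
  have δ₂le : ‖δ₂‖ ≤ 1 := nδ₂ ▸ hpow1 _
  have ε₁le : ‖ε₁‖ ≤ 1 := nε₁ ▸ hpow1 _
  have ε₂le : ‖ε₂‖ ≤ 1 := nε₂ ▸ hpow1 _
  have hΛle : ∀ i j, ‖Λ i j‖ ≤ 1 := by
    rcases hΛ with rfl | rfl <;> intro i j <;> fin_cases i <;> fin_cases j <;>
      first | exact norm_one.le | assumption
  have hΛ0 : ∀ i j, Λ i j ≠ 0 := by
    have h1 := hne _ _ nδ₁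
    have h2 := hne _ _ nδ₂
    have h3 := hne _ _ nε₁
    have h4 := hne _ _ nε₂
    rcases hΛ with rfl | rfl <;> intro i j <;> fin_cases i <;> fin_cases j <;>
      first | exact one_ne_zero | assumption
  have hNΛ : Λ⁻¹ * Λ = 1 := Matrix.nonsing_inv_mul _ (hne _ _ ndet).isUnit
  have hdeg : (∃ i j, 1 < ‖Λ i j * Λ⁻¹ j i‖) →
      IndependenceForces.{u} Λ (degenerateDistributions ℚ_[p]) := by
    rintro ⟨i, j, hij⟩
    exact .degenerate_of_one_lt_norm hNΛ hij (hΛ0 i)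
  -- for `q > 0` the inverse is not integral, since its determinant is not
  have hNnot : 0 < q → ¬ ∀ i j, ‖Λ⁻¹ i j‖ ≤ 1 := by
    intro hq h
    have h1 := Matrix.norm_det_le_one h
    have h2 : ‖Λ⁻¹.det‖ * ‖Λ.det‖ = 1 := by
      rw [← norm_mul, ← Matrix.det_mul, hNΛ, Matrix.det_one, norm_one]
    have h3 : ‖Λ.det‖ < 1 := by
      rw [ndet]
      exact pow_lt_one₀ hp0.le hp1 hq.ne'
    nlinarith [norm_nonneg Λ.det]
  refine ⟨fun hq => ?_, fun hq => ⟨fun hu => ?_, fun hnu => ?_⟩⟩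
  · obtain ⟨N, hN1, hN⟩ := Matrix.exists_integral_leftInverse hΛle (by rw [ndet, hq, pow_zero])
    rw [independenceForces_idempotent_iff hN1 hΛle hN, twoUnitsInLines_iff_ncard]
  · simp only [mem_padicUnits_iff] at hu
    apply hdeg
    by_contra! h
    refine hNnot hq ?_
    rcases hΛ with rfl | rfl
    · exact Lambda1_inverse_integral hNΛ h hu
    · exact Lambda2_inverse_integral hNΛ h δ₁le ε₁le
  · simp only [mem_padicUnits_iff] at hnu
    obtain ⟨u1, u2, u3, u4⟩ := hnu
    have δ₁lt := lt_of_le_of_ne δ₁le u1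
    have δ₂lt := lt_of_le_of_ne δ₂le u2
    have ε₁lt := lt_of_le_of_ne ε₁le u3
    have ε₂lt := lt_of_le_of_ne ε₂le u4
    rcases hΛ with rfl | rfl
    swap
    · -- here the determinant of `Lambda2` is a unit
      rw [norm_det_Lambda2_eq_one δ₁lt δ₂lt ε₁lt ε₂lt] at ndet
      exact absurd ndet.symm (pow_lt_one₀ hp0.le hp1 hq.ne').ne
    have hk₁ : k ≤ k₁ := by omega
    have hk₂ : k ≤ k₂ := by omega
    have hl₁ : k ≤ l₁ := by omega
    have hl₂ : k ≤ l₂ := by omega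
    have hkpos : 0 < k := by
      have hz : ∀ (x : ℚ_[p]) (n : ℕ), ‖x‖ = (p : ℝ)⁻¹ ^ n → ‖x‖ ≠ 1 → n ≠ 0 := by
        rintro x n hx hx1 rfl
        exact hx1 (by rw [hx, pow_zero])
      have := hz _ _ nδ₁ u1
      have := hz _ _ nδ₂ u2
      have := hz _ _ nε₁ u3
      have := hz _ _ nε₂ u4
      omega
    have hkq : k ≤ q := by
      by_contra! h
      have h1 := norm_det_Lambda1_le (r := (p : ℝ)⁻¹ ^ k) (nδ₁ ▸ hpowle hk₁) (nδ₂ ▸ hpowle hk₂)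
        (nε₁ ▸ hpowle hl₁) (nε₂ ▸ hpowle hl₂) (hpow1 k)
      rw [ndet] at h1
      exact absurd (hpowlt h) (not_lt.2 h1)
    have hB : k < q → IndependenceForces.{u} (Lambda1 δ₁ δ₂ ε₁ ε₂)
        (degenerateDistributions ℚ_[p]) := by
      intro hlt
      -- the entry of norm `p⁻ᵏ` is multiplied by an entry of the inverse of norm `pᵠ`
      obtain ⟨i, j, hi, hj, hij⟩ : ∃ i j : Fin 3, i ≠ 0 ∧ j ≠ 0 ∧
          ‖Lambda1 δ₁ δ₂ ε₁ ε₂ i j‖ = (p : ℝ)⁻¹ ^ k := by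
        have : k = k₁ ∨ k = k₂ ∨ k = l₁ ∨ k = l₂ := by omega
        rcases this with h | h | h | h
        · exact ⟨1, 1, by simp, by simp, by rw [h]; exact nδ₁⟩
        · exact ⟨1, 2, by simp, by simp, by rw [h]; exact nδ₂⟩
        · exact ⟨2, 1, by simp, by simp, by rw [h]; exact nε₁⟩
        · exact ⟨2, 2, by simp, by simp, by rw [h]; exact nε₂⟩
      refine hdeg ⟨i, j, ?_⟩
      have h1 := norm_det_mul_Lambda1_inverse δ₁lt δ₂lt ε₁lt ε₂lt hNΛ hj hi
      rw [ndet] at h1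
      rw [norm_mul, hij, ← h1]
      have hNpos : 0 < ‖(Lambda1 δ₁ δ₂ ε₁ ε₂)⁻¹ j i‖ :=
        pos_of_mul_pos_right (h1.symm ▸ one_pos) (pow_nonneg hp0.le q)
      exact mul_lt_mul_of_pos_right (hpowlt hlt) hNpos
    refine ⟨?_, hB⟩
    rcases hkq.lt_or_eq with hlt | heq
    · refine iff_of_true (fun Ω _ P _ ξ hm hξ hL j => ?_) (Or.inl hlt)
      have hpr : IsProbabilityMeasure (P.map (ξ j)) :=
        Measure.isProbabilityMeasure_map (hm j).aemeasurable
      exact degenerateDistributions_subset_idempotentDistributions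
        (hB hlt Ω P ξ hm hξ hL j)
    · have hx : ‖(p : ℚ_[p]) ^ k‖ = (p : ℝ)⁻¹ ^ k := by rw [norm_pow, Padic.norm_p]
      rw [independenceForces_idempotent_Lambda1_iff (x := (p : ℚ_[p]) ^ k) (hne _ _ hx)
        (hx ▸ pow_lt_one₀ hp0.le hp1 hkpos.ne') (by rw [hx, nδ₁]; exact hpowle hk₁)
        (by rw [hx, nδ₂]; exact hpowle hk₂) (by rw [hx, nε₁]; exact hpowle hl₁)
        (by rw [hx, nε₂]; exact hpowle hl₂) (by rw [hx, ndet, heq])]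
      rw [hx, nδ₁, nδ₂, nε₁, nε₂]
      simp only [hpowinj]
      constructor
      · exact fun h => Or.inr ⟨heq.symm, h⟩
      · rintro (h | h)
        · omega
        · exact h.2
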